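/- Let $L>0$, let $d$ be a dimension, and let $\mathbb T^d=(\mathbb R/L\mathbb Z)^d$. Write $\mathbb R^+$ for the time half-line, $L^2_{\mathrm{div}}(\mathbb T^d)$ for the space of vector fields in $L^2(\mathbb T^d;\mathbb R^d)$ whose distributional divergence vanishes, and $H^1_{\mathrm{div}}(\mathbb T^d)=L^2_{\mathrm{div}}\cap H^1(\mathbb T^d;\mathbb R^d)$. Let $q\in(1,\infty]$ and let $U:\mathbb R^+\times\mathbb T^d\to\mathbb R^d$ satisfy $$U\in L^\infty(\mathbb R^+;W^{1,q}(\mathbb T^d))\cap L^1(\mathbb R^+;W^{1,\infty}(\mathbb T^d)),\qquad \operatorname{div}U(t)=0\ \text{ for a.e. } t>0 .$$ For $u_0\in L^2_{\mathrm{div}}(\mathbb T^d)$, a weak solution of $$\partial_t u+(U\cdot\nabla)u+\nabla p=0,\qquad \operatorname{div}u=0,\qquad u(0)=u_0$$ is a field $u\in L^\infty(\mathbb R^+;L^2_{\mathrm{div}}(\mathbb T^d))$ such that $$\int_{\mathbb R^+}\int_{\mathbb T^d}\big(u\cdot\partial_t\varphi+[(U\cdot\nabla)\varphi]\cdot u\big)\,dx\,dt+\int_{\mathbb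 T^d}u_0\cdot\varphi(0,x)\,dx=0$$ for every smooth vector field $\varphi\in C_c^\infty([0,\infty)\times\mathbb T^d;\mathbb R^d)$ with $\operatorname{div}\varphi=0$. Then: 1. For every $u_0\in L^2_{\mathrm{div}}(\mathbb T^d)$, weak solutions are unique: any two weak solutions with initial data $u_0$ coincide almost everywhere on $\mathbb R^+\times\mathbb T^d$. 2. If $u$ and $v$ are weak solutions with initial data $u_0,v_0\in L^2_{\mathrm{div}}(\mathbb T^d)$ respectively, then for almost every $t>0$ $$\int_{\mathbb T^d}|u(t,x)-v(t,x)|^2\,dx\le\int_{\mathbb T^d}|u_0-v_0|^2\,dx .$$ 3. If moreover $u_0,v_0\in H^1_{\mathrm{div}}(\mathbb T^d)$, then for almost every $t>0$ $$\int_{\mathbb T^d}|u(t,x)-v(t,x)|^2\,dx=\int_{\mathbb T^d}|u_0-v_0|^2\,dx .$$ -/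

import Mathlib

open MeasureTheory Set
open scoped ENNReal ContDiff

noncomputable section

/-- The `d`-dimensional torus of side length `L`. Its `volume` is the product Lebesgue measure,
of total mass `L ^ d`. -/
abbrev Torus (d : ℕ) (L : ℝ) : Type := Fin d → AddCircle L

/-- The covering map `ℝ^d → 𝕋^d`. -/
def toTorus (d : ℕ) (L : ℝ) (y : Fin d → ℝ) : Torus d L := fun i => (y i : AddCircle L)

/-- Time runs over `ℝ⁺ = (0, ∞)` with Lebesgue measure. -/
abbrev timeMeasure : Measure ℝ := volume.restrict (Ioi (0 : ℝ))

/-- The classical partial derivative `∂ᵢ f (x)` of a function on the torus. -/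
def torusPartial {d : ℕ} {L : ℝ} {E : Type*} [NormedAddCommGroup E] [NormedSpace ℝ E]
    (i : Fin d) (f : Torus d L → E) (x : Torus d L) : E :=
  deriv (fun s : ℝ => f (x + Pi.single i (s : AddCircle L))) 0

/-- Scalar `C^∞` functions on the torus. -/
def IsSmoothTorus {d : ℕ} {L : ℝ} (ψ : Torus d L → ℝ) : Prop :=
  ContDiff ℝ ∞ (fun y : Fin d → ℝ => ψ (toTorus d L y))

/-- `g` is the weak (distributional) `i`-th partial derivative of `f` on the torus
(used for integrable `f`, `g`). -/
def IsWeakPartial {d : ℕ} {L : ℝ} [Fact (0 < L)] (i : Fin d)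
    (f g : Torus d L → EuclideanSpace ℝ (Fin d)) : Prop :=
  ∀ ψ : Torus d L → ℝ, IsSmoothTorus ψ →
    ∫ x, torusPartial i ψ x • f x = - ∫ x, ψ x • g x

/-- `div w = 0` in the sense of distributions on the torus. -/
def IsWeaklyDivFree {d : ℕ} {L : ℝ} [Fact (0 < L)]
    (w : Torus d L → EuclideanSpace ℝ (Fin d)) : Prop :=
  ∀ ψ : Torus d L → ℝ, IsSmoothTorus ψ →
    ∫ x, ∑ i, w x i * torusPartial i ψ x = 0

/-- `w ∈ L²_div(𝕋^d)`. -/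
def MemL2Div {d : ℕ} {L : ℝ} [Fact (0 < L)]
    (w : Torus d L → EuclideanSpace ℝ (Fin d)) : Prop :=
  MemLp w 2 volume ∧ IsWeaklyDivFree w

/-- `w ∈ H¹_div(𝕋^d)`. -/
def MemH1Div {d : ℕ} {L : ℝ} [Fact (0 < L)]
    (w : Torus d L → EuclideanSpace ℝ (Fin d)) : Prop :=
  MemL2Div w ∧ ∀ i, ∃ g : Torus d L → EuclideanSpace ℝ (Fin d),
    MemLp g 2 volume ∧ IsWeakPartial i w g

/-- `f ∈ L^r(ℝ⁺; L^p(𝕋^d))`: `f` is jointly measurable on `ℝ⁺ × 𝕋^d` and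
`t ↦ ‖f(t)‖_{L^p}` belongs to `L^r(ℝ⁺)`. -/
def MemTimeLp {d : ℕ} {L : ℝ} [Fact (0 < L)] (r p : ℝ≥0∞)
    (f : ℝ → Torus d L → EuclideanSpace ℝ (Fin d)) : Prop :=
  AEStronglyMeasurable (fun z : ℝ × Torus d L => f z.1 z.2) (timeMeasure.prod volume) ∧
    MemLp (fun t => eLpNorm (f t) p volume) r timeMeasure

/-- `f ∈ L^r(ℝ⁺; W^{1,p}(𝕋^d))`. -/
def MemTimeW1p {d : ℕ} {L : ℝ} [Fact (0 < L)] (r p : ℝ≥0∞)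
    (f : ℝ → Torus d L → EuclideanSpace ℝ (Fin d)) : Prop :=
  MemTimeLp r p f ∧ ∃ G : Fin d → ℝ → Torus d L → EuclideanSpace ℝ (Fin d),
    (∀ i, MemTimeLp r p (G i)) ∧ ∀ᵐ t ∂timeMeasure, ∀ i, IsWeakPartial i (f t) (G i t)

/-- Divergence-free vector-valued test functions, smooth and compactly supported in time; the
support may meet `t = 0` (they are restrictions to `t ≥ 0` of smooth functions on `ℝ × 𝕋^d`). -/
structure IsTestField {d : ℕ} {L : ℝ}
    (φ : ℝ → Torus d L → EuclideanSpace ℝ (Fin d)) : Prop where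
  smooth : ContDiff ℝ ∞ (fun z : ℝ × (Fin d → ℝ) => φ z.1 (toTorus d L z.2))
  compactSupport : HasCompactSupport (fun z : ℝ × Torus d L => φ z.1 z.2)
  divFree : ∀ t x, ∑ i, torusPartial i (φ t) x i = 0

/-- `u` is a weak solution of `∂ₜu + (U·∇)u + ∇p = 0`, `div u = 0`, `u(0) = u₀`:
`u ∈ L^∞(ℝ⁺; L²_div)` and the weak formulation holds for all divergence-free test fields
(so that the pressure drops out). -/
structure IsWeakSolution {d : ℕ} {L : ℝ} [Fact (0 < L)]
    (U : ℝ → Torus d L → EuclideanSpace ℝ (Fin d))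
    (u₀ : Torus d L → EuclideanSpace ℝ (Fin d))
    (u : ℝ → Torus d L → EuclideanSpace ℝ (Fin d)) : Prop where
  bounded : MemTimeLp ∞ 2 u
  divFree : ∀ᵐ t ∂timeMeasure, IsWeaklyDivFree (u t)
  weakForm : ∀ φ : ℝ → Torus d L → EuclideanSpace ℝ (Fin d), IsTestField φ →
    (∫ t in Ioi (0 : ℝ), ∫ x,
        (inner ℝ (u t x) (deriv (fun s => φ s x) t)
          + inner ℝ (∑ i, U t x i • torusPartial i (φ t) x) (u t x)))
      + ∫ x, inner ℝ (u₀ x) (φ 0 x) = 0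

end

noncomputable section

section

variable {d : ℕ} {L : ℝ} {F : Type*} [NormedAddCommGroup F] [NormedSpace ℝ F]

/-- `C^∞` maps from the torus to a normed space. -/
def TorusSmooth (f : Torus d L → F) : Prop :=
  ContDiff ℝ ∞ (fun y : Fin d → ℝ => f (toTorus d L y))

theorem toTorus_isOpenQuotientMap : IsOpenQuotientMap (toTorus d L) :=
  IsOpenQuotientMap.piMap fun _ => QuotientAddGroup.isOpenQuotientMap_mk

theorem toTorus_add (y z : Fin d → ℝ) : toTorus d L (y + z) = toTorus d L y + toTorus d L z := rfl

theorem toTorus_neg (y : Fin d → ℝ) : toTorus d L (-y) = -toTorus d L y := rfl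

theorem toTorus_single (i : Fin d) (s : ℝ) :
    toTorus d L (Pi.single i s) = Pi.single i (s : AddCircle L) := by
  ext j
  by_cases h : j = i
  · subst h; simp [toTorus]
  · simp [toTorus, h]

theorem torusPartial_toTorus (i : Fin d) {f : Torus d L → F} {y : Fin d → ℝ}
    {f' : (Fin d → ℝ) →L[ℝ] F} (hf : HasFDerivAt (fun y => f (toTorus d L y)) f' y) :
    torusPartial i f (toTorus d L y) = f' (Pi.single i 1) := by
  have h1 : HasDerivAt (fun s : ℝ => y + s • (Pi.single i 1 : Fin d → ℝ))
      (Pi.single i 1 : Fin d → ℝ) 0 := by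
    simpa using ((hasDerivAt_id (0 : ℝ)).smul_const (Pi.single i 1 : Fin d → ℝ)).const_add y
  have hf0 : HasFDerivAt (fun y => f (toTorus d L y)) f'
      (y + (0 : ℝ) • (Pi.single i 1 : Fin d → ℝ)) := by simpa using hf
  have h2 := hf0.comp_hasDerivAt (0 : ℝ) h1
  rw [torusPartial, ← h2.deriv]
  congr 1
  ext s
  simp only [Function.comp_apply, toTorus_add, ← toTorus_single]
  congr 3
  ext j
  by_cases h : j = i
  · subst h; simp
  · simp [h]

theorem TorusSmooth.hasFDerivAt {f : Torus d L → F} (hf : TorusSmooth f) (y : Fin d → ℝ) :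
    HasFDerivAt (fun y => f (toTorus d L y))
      (fderiv ℝ (fun y => f (toTorus d L y)) y) y :=
  (ContDiff.differentiable hf (by simp) y).hasFDerivAt

theorem TorusSmooth.torusPartial {f : Torus d L → F} (hf : TorusSmooth f) (i : Fin d) :
    TorusSmooth (torusPartial i f) := by
  have h : (fun y => _root_.torusPartial i f (toTorus d L y)) =
      fun y => fderiv ℝ (fun y => f (toTorus d L y)) y (Pi.single i 1) := by
    ext y
    exact torusPartial_toTorus i (hf.hasFDerivAt y)
  rw [TorusSmooth, h]
  exact (ContDiff.fderiv_right hf (by simp)).clm_apply contDiff_const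

theorem TorusSmooth.hasFDerivAt_sum {f : Torus d L → F} (hf : TorusSmooth f) (y : Fin d → ℝ) :
    HasFDerivAt (fun y => f (toTorus d L y))
      (∑ i, (ContinuousLinearMap.proj (R := ℝ) (φ := fun _ : Fin d => ℝ) i).smulRight
        (_root_.torusPartial i f (toTorus d L y))) y := by
  refine (hf.hasFDerivAt y).congr_fderiv (ContinuousLinearMap.ext fun v => ?_)
  have hv : v = ∑ i, v i • (Pi.single i 1 : Fin d → ℝ) := by
    ext j; simp [Finset.sum_apply, Pi.single_apply]
  conv_lhs => rw [hv, map_sum]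
  simp [torusPartial_toTorus _ (hf.hasFDerivAt y)]

theorem TorusSmooth.continuous {f : Torus d L → F} (hf : TorusSmooth f) : Continuous f :=
  toTorus_isOpenQuotientMap.isQuotientMap.continuous_iff.2 (ContDiff.continuous hf)

theorem TorusSmooth.comp_sub_right {f : Torus d L → F} (hf : TorusSmooth f) (x : Torus d L) :
    TorusSmooth (fun z => f (z - x)) := by
  obtain ⟨x, rfl⟩ := toTorus_isOpenQuotientMap.surjective x
  exact ContDiff.comp (g := fun y => f (toTorus d L y)) hf (contDiff_id.sub contDiff_const)

theorem TorusSmooth.comp_neg {f : Torus d L → F} (hf : TorusSmooth f) :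
    TorusSmooth (fun z => f (-z)) :=
  ContDiff.comp (g := fun y => f (toTorus d L y)) hf contDiff_neg

theorem TorusSmooth.comp_sub_left {f : Torus d L → F} (hf : TorusSmooth f) (x : Torus d L) :
    TorusSmooth (fun z => f (x - z)) := by
  obtain ⟨x, rfl⟩ := toTorus_isOpenQuotientMap.surjective x
  exact ContDiff.comp (g := fun y => f (toTorus d L y)) hf (contDiff_const.sub contDiff_id)

theorem torusPartial_comp_sub_right (i : Fin d) (f : Torus d L → F) (x z : Torus d L) :
    torusPartial i (fun z => f (z - x)) z = torusPartial i f (z - x) := by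
  simp only [torusPartial]
  congr 1
  ext s
  congr 1
  abel

theorem torusPartial_comp_neg (i : Fin d) (f : Torus d L → F) (z : Torus d L) :
    torusPartial i (fun z => f (-z)) z = -torusPartial i f (-z) := by
  simp only [torusPartial]
  have := deriv_comp_neg (fun s : ℝ => f (-z + Pi.single i (s : AddCircle L))) 0
  rw [neg_zero] at this
  rw [← this]
  congr 1
  ext s
  congr 1
  rw [neg_add, ← Pi.single_neg, ← AddCircle.coe_neg]

theorem torusPartial_comp_sub_left (i : Fin d) (f : Torus d L → F) (x z : Torus d L) :
    torusPartial i (fun z => f (x - z)) z = -torusPartial i f (x - z) := by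
  have h := torusPartial_comp_neg i (fun y => f (y - (-x))) z
  rw [torusPartial_comp_sub_right] at h
  simpa [sub_eq_add_neg, add_comm] using h

/-- The supremum distance on the torus is attained by representatives. -/
theorem exists_toTorus_norm_eq [Fact (0 < L)] (x : Torus d L) :
    ∃ y : Fin d → ℝ, toTorus d L y = x ∧ ‖y‖ = ‖x‖ ∧ ∀ i, |y i| ≤ L / 2 ∧ ‖x i‖ = |y i| := by
  have hL : 0 < L := Fact.out
  have h : ∀ i, ∃ y : ℝ, (y : AddCircle L) = x i ∧ |y| ≤ L / 2 := by
    intro i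
    obtain ⟨y, hy⟩ := QuotientAddGroup.mk_surjective (x i)
    refine ⟨y - round (L⁻¹ * y) * L, ?_, ?_⟩
    · rw [AddCircle.coe_sub, ← hy]
      have : ((round (L⁻¹ * y) * L : ℝ) : AddCircle L) = 0 := by
        rw [AddCircle.coe_eq_zero_iff]
        exact ⟨round (L⁻¹ * y), by simp⟩
      rw [this, sub_zero]
    · rw [← AddCircle.norm_eq]
      simpa [abs_of_pos hL] using AddCircle.norm_le_half_period L (x := (y : AddCircle L)) hL.ne'
  choose y hy hy2 using h
  have hn : ∀ i, ‖x i‖ = |y i| := fun i => by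
    rw [← hy i]
    exact (AddCircle.norm_coe_eq_abs_iff L hL.ne').2 (by simpa [abs_of_pos hL] using hy2 i)
  refine ⟨y, funext hy, ?_, fun i => ⟨hy2 i, hn i⟩⟩
  simp only [Pi.norm_def]
  congr 2
  ext i
  simp [hn i]

variable [Fact (0 < L)]

theorem TorusSmooth.exists_bound {f : Torus d L → F} (hf : TorusSmooth f) :
    ∃ C, 0 ≤ C ∧ ∀ x, ‖f x‖ ≤ C := by
  obtain ⟨C, hC⟩ := isCompact_univ.exists_bound_of_continuousOn hf.continuous.continuousOn
  exact ⟨C, (norm_nonneg _).trans (hC 0 trivial), fun x => hC x trivial⟩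

theorem TorusSmooth.norm_sub_le {f : Torus d L → F} (hf : TorusSmooth f) {C : ℝ}
    (hC : ∀ x, ∑ i, ‖_root_.torusPartial i f x‖ ≤ C) (x z : Torus d L) :
    ‖f x - f z‖ ≤ C * ‖x - z‖ := by
  obtain ⟨a, rfl⟩ := toTorus_isOpenQuotientMap.surjective z
  obtain ⟨b, hb, hb2, -⟩ := exists_toTorus_norm_eq (x - toTorus d L a)
  obtain rfl : x = toTorus d L (a + b) := by rw [toTorus_add, hb]; abel
  rw [← hb2]
  have := Convex.norm_image_sub_le_of_norm_hasFDerivWithin_le (C := C) (s := univ)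
    (fun y _ => (hf.hasFDerivAt_sum y).hasFDerivWithinAt) ?_ convex_univ (mem_univ a)
    (mem_univ (a + b))
  · simpa using this
  intro y _
  refine ContinuousLinearMap.opNorm_le_bound _ ((Finset.sum_nonneg fun _ _ => norm_nonneg _).trans
    (hC 0)) fun v => ?_
  rw [sum_apply]
  refine (norm_sum_le _ _).trans ?_
  calc _ ≤ ∑ i, ‖_root_.torusPartial i f (toTorus d L y)‖ * ‖v‖ := by
        refine Finset.sum_le_sum fun i _ => ?_
        rw [ContinuousLinearMap.smulRight_apply, norm_smul, mul_comm]
        gcongr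
        exact norm_le_pi_norm v i
    _ = (∑ i, ‖_root_.torusPartial i f (toTorus d L y)‖) * ‖v‖ := by rw [Finset.sum_mul]
    _ ≤ _ := by gcongr; exact hC _

instance torus_isNegInvariant : (volume : Measure (Torus d L)).IsNegInvariant :=
  Measure.IsAddHaarMeasure.isNegInvariant_of_regular _

end

section

variable {d : ℕ} {L : ℝ} [Fact (0 < L)] {F : Type*} [NormedAddCommGroup F] [NormedSpace ℝ F]

/-- Convolution on the torus of a scalar kernel with a vector-valued function. -/
def torusConv (k : Torus d L → ℝ) (z : Torus d L → F) (x : Torus d L) : F :=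
  ∫ y, k (x - y) • z y

theorem integrable_kernel_smul {k : Torus d L → ℝ} (hk : TorusSmooth k) {z : Torus d L → F}
    (hz : Integrable z) (x : Torus d L) : Integrable (fun y => k (x - y) • z y) := by
  obtain ⟨C, -, hC⟩ := hk.exists_bound
  exact hz.bdd_smul C ((hk.continuous.comp (continuous_const.sub
    continuous_id)).aestronglyMeasurable) (ae_of_all _ fun y => hC _)

theorem norm_torusConv_le {k : Torus d L → ℝ} {C : ℝ} (hC : ∀ x, ‖k x‖ ≤ C)
    {z : Torus d L → F} (hz : Integrable z) (x : Torus d L) :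
    ‖torusConv k z x‖ ≤ C * ∫ y, ‖z y‖ := by
  rw [torusConv, ← integral_const_mul]
  refine norm_integral_le_of_norm_le (hz.norm.const_mul C) (ae_of_all _ fun y => ?_)
  rw [norm_smul]
  gcongr
  exact hC _

theorem torusConv_sub {k : Torus d L → ℝ} (hk : TorusSmooth k) {z z' : Torus d L → F}
    (hz : Integrable z) (hz' : Integrable z') (x : Torus d L) :
    torusConv k (fun y => z y - z' y) x = torusConv k z x - torusConv k z' x := by
  simp only [torusConv, smul_sub]
  exact integral_sub (integrable_kernel_smul hk hz x) (integrable_kernel_smul hk hz' x)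

theorem torusConv_add {k : Torus d L → ℝ} (hk : TorusSmooth k) {z z' : Torus d L → F}
    (hz : Integrable z) (hz' : Integrable z') (x : Torus d L) :
    torusConv k (fun y => z y + z' y) x = torusConv k z x + torusConv k z' x := by
  simp only [torusConv, smul_add]
  exact integral_add (integrable_kernel_smul hk hz x) (integrable_kernel_smul hk hz' x)

theorem torusConv_congr_ae (k : Torus d L → ℝ) {z z' : Torus d L → F} (h : z =ᵐ[volume] z') :
    torusConv k z = torusConv k z' := by
  ext x
  exact integral_congr_ae (h.mono fun y hy => by simp [hy])

theorem torusConv_eq_integral_shift (k : Torus d L → ℝ) (z : Torus d L → F) (x : Torus d L) :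
    torusConv k z x = ∫ y, k y • z (x - y) := by
  rw [torusConv, ← integral_sub_left_eq_self _ volume x]
  simp

theorem integrable_smulRight {α V : Type*} [MeasurableSpace α] {μ : Measure α}
    [NormedAddCommGroup V] [NormedSpace ℝ V] (π : V →L[ℝ] ℝ) {g : α → F} (hg : Integrable g μ) :
    Integrable (fun a => π.smulRight (g a)) μ :=
  (ContinuousLinearMap.smulRightL ℝ V F π).integrable_comp hg

variable [CompleteSpace F]

theorem integral_smulRight {α V : Type*} [MeasurableSpace α] {μ : Measure α}
    [NormedAddCommGroup V] [NormedSpace ℝ V] (π : V →L[ℝ] ℝ) {g : α → F} (hg : Integrable g μ) :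
    ∫ a, π.smulRight (g a) ∂μ = π.smulRight (∫ a, g a ∂μ) :=
  (ContinuousLinearMap.smulRightL ℝ V F π).integral_comp_comm hg

theorem integrable_sum_of_normedAddCommGroup {α ι W : Type*} [Fintype ι] [MeasurableSpace α]
    {μ : Measure α} [NormedAddCommGroup W] {f : ι → α → W} (hf : ∀ i, Integrable (f i) μ) :
    Integrable (fun a => ∑ i, f i a) μ :=
  integrable_finsetSum _ fun i _ => hf i

theorem hasFDerivAt_integral_sum_smulRight {α V ι : Type*} [Fintype ι] [MeasurableSpace α]
    {μ : Measure α} [NormedAddCommGroup V] [NormedSpace ℝ V] {π : ι → V →L[ℝ] ℝ}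
    (hπ : ∀ i, ‖π i‖ ≤ 1) {f : V → α → F} {g : ι → V → α → F} {B : ι → α → ℝ}
    (hf : ∀ y, Integrable (f y) μ) (hg : ∀ i y, Integrable (g i y) μ)
    (hB : ∀ i, Integrable (B i) μ) (hgB : ∀ i y a, ‖g i y a‖ ≤ B i a)
    (hfg : ∀ y a, HasFDerivAt (fun y => f y a) (∑ i, (π i).smulRight (g i y a)) y) (y : V) :
    HasFDerivAt (fun y => ∫ a, f y a ∂μ) (∑ i, (π i).smulRight (∫ a, g i y a ∂μ)) y := by
  have hint : ∀ i y, Integrable (fun a => (π i).smulRight (g i y a)) μ := fun i y =>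
    integrable_smulRight _ (hg i y)
  have key := hasFDerivAt_integral_of_dominated_of_fderiv_le (𝕜 := ℝ) (μ := μ) (s := univ)
    (x₀ := y) (F := f) (F' := fun y a => ∑ i, (π i).smulRight (g i y a))
    (bound := fun a => ∑ i, B i a) Filter.univ_mem
    (Filter.Eventually.of_forall fun y => (hf y).aestronglyMeasurable) (hf y)
    (integrable_sum_of_normedAddCommGroup fun i => hint i y).aestronglyMeasurable
    (ae_of_all _ fun a y _ => (norm_sum_le _ _).trans (Finset.sum_le_sum fun i _ => ?_))
    (integrable_finsetSum _ fun i _ => hB i) (ae_of_all _ fun a y _ => hfg y a)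
  · refine key.congr_fderiv ?_
    rw [integral_finsetSum _ fun i _ => hint i y]
    exact Finset.sum_congr rfl fun i _ => integral_smulRight _ (hg i y)
  · rw [ContinuousLinearMap.norm_smulRight_apply]
    calc _ ≤ 1 * B i a := mul_le_mul (hπ i) (hgB i y a) (norm_nonneg _) zero_le_one
      _ = _ := one_mul _

theorem norm_proj_le_one (i : Fin d) :
    ‖ContinuousLinearMap.proj (R := ℝ) (φ := fun _ : Fin d => ℝ) i‖ ≤ 1 :=
  ContinuousLinearMap.opNorm_le_bound _ zero_le_one fun v => by
    simpa using norm_le_pi_norm v i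

theorem hasFDerivAt_torusConv {k : Torus d L → ℝ} (hk : TorusSmooth k) {z : Torus d L → F}
    (hz : Integrable z) (y : Fin d → ℝ) :
    HasFDerivAt (fun y => torusConv k z (toTorus d L y))
      (∑ i, (ContinuousLinearMap.proj (R := ℝ) (φ := fun _ : Fin d => ℝ) i).smulRight
        (torusConv (torusPartial i k) z (toTorus d L y))) y := by
  choose C hC0 hC using fun i => (hk.torusPartial i).exists_bound
  refine hasFDerivAt_integral_sum_smulRight norm_proj_le_one (B := fun i a => C i * ‖z a‖)
    (fun y => integrable_kernel_smul hk hz _)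
    (fun i y => integrable_kernel_smul (hk.torusPartial i) hz _)
    (fun i => hz.norm.const_mul _) (fun i y a => ?_) (fun y a => ?_) y
  · rw [norm_smul]
    exact mul_le_mul_of_nonneg_right (hC i _) (norm_nonneg _)
  · have h := ((hk.comp_sub_right a).hasFDerivAt_sum y).smul_const (z a)
    refine h.congr_fderiv (ContinuousLinearMap.ext fun v => ?_)
    simp [torusPartial_comp_sub_right, Finset.sum_smul, mul_smul]

theorem TorusSmooth.conv {k : Torus d L → ℝ} (hk : TorusSmooth k) {z : Torus d L → F}
    (hz : Integrable z) : TorusSmooth (torusConv k z) := by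
  refine contDiff_infty.2 fun n => ?_
  induction n generalizing k with
  | zero =>
    exact contDiff_zero.2 (continuous_iff_continuousAt.2 fun y =>
      (hasFDerivAt_torusConv hk hz y).continuousAt)
  | succ n ih =>
    push_cast
    refine contDiff_succ_iff_hasFDerivAt.2 ⟨_, ?_, hasFDerivAt_torusConv hk hz⟩
    exact ContDiff.sum fun i _ => contDiff_const.smulRight (ih (hk.torusPartial i))

theorem torusPartial_torusConv {k : Torus d L → ℝ} (hk : TorusSmooth k) {z : Torus d L → F}
    (hz : Integrable z) (i : Fin d) (x : Torus d L) :
    torusPartial i (torusConv k z) x = torusConv (torusPartial i k) z x := by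
  obtain ⟨y, rfl⟩ := toTorus_isOpenQuotientMap.surjective x
  rw [torusPartial_toTorus i (hasFDerivAt_torusConv hk hz y)]
  simp [sum_apply, Pi.single_apply]

theorem integral_inner_torusConv {E : Type*} [NormedAddCommGroup E] [InnerProductSpace ℝ E]
    [CompleteSpace E] {k : Torus d L → ℝ} (hk : TorusSmooth k) {f z : Torus d L → E}
    (hf : Integrable f) (hz : Integrable z) :
    ∫ x, inner ℝ (f x) (torusConv k z x) =
      ∫ x, inner ℝ (torusConv (fun y => k (-y)) f x) (z x) := by
  obtain ⟨C, hC0, hC⟩ := hk.exists_bound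
  have hint : Integrable (fun p : Torus d L × Torus d L => k (p.1 - p.2) * inner ℝ (f p.1) (z p.2))
      (volume.prod volume) := by
    refine ((hf.norm.mul_prod hz.norm).const_mul C).mono' ?_ (ae_of_all _ fun p => ?_)
    · exact (hk.continuous.comp (continuous_fst.sub continuous_snd)).aestronglyMeasurable.mul
        (hf.aestronglyMeasurable.comp_fst.inner hz.aestronglyMeasurable.comp_snd)
    · rw [norm_mul]
      exact mul_le_mul (hC _) (norm_inner_le_norm _ _) (norm_nonneg _) hC0
  calc _ = ∫ x, ∫ y, k (x - y) * inner ℝ (f x) (z y) := by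
        congr 1; ext x
        rw [torusConv, ← integral_inner (integrable_kernel_smul hk hz x)]
        simp [inner_smul_right]
    _ = ∫ y, ∫ x, k (x - y) * inner ℝ (f x) (z y) := integral_integral_swap hint
    _ = _ := by
        congr 1; ext y
        rw [torusConv, real_inner_comm, ← integral_inner (integrable_kernel_smul hk.comp_neg hf y)]
        congr 1; ext x
        rw [inner_smul_right, neg_sub, real_inner_comm]

end

section

/-- `k` is a smooth even probability density on the torus, supported in the ball of radius `r`,
whose gradient has first moment at most `C`. -/
structure IsMollifier {d : ℕ} {L : ℝ} [Fact (0 < L)] (k : Torus d L → ℝ) (r C : ℝ) : Prop where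
  smooth : TorusSmooth k
  even : ∀ x, k (-x) = k x
  nonneg : ∀ x, 0 ≤ k x
  integral_eq_one : ∫ x, k x = 1
  eq_zero : ∀ x, r < ‖x‖ → k x = 0
  partial_eq_zero : ∀ i x, r < ‖x‖ → torusPartial i k x = 0
  moment_le : ∀ i, ∫ x, ‖x‖ * |torusPartial i k x| ≤ C

variable {d : ℕ} {L : ℝ} [hL : Fact (0 < L)]

theorem periodic_cos_two_pi_div (L : ℝ) [hL : Fact (0 < L)] :
    Function.Periodic (fun y : ℝ => Real.cos (2 * Real.pi / L * y)) L := fun y => by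
  have := hL.out.ne'
  have h : 2 * Real.pi / L * (y + L) = 2 * Real.pi / L * y + 2 * Real.pi := by field_simp
  simp only [h, Real.cos_add_two_pi]

/-- The function `cos (2πy/L)` on `ℝ/Lℤ`. -/
def circleCos (L : ℝ) [Fact (0 < L)] : AddCircle L → ℝ := (periodic_cos_two_pi_div L).lift

theorem circleCos_coe (y : ℝ) : circleCos L (y : AddCircle L) = Real.cos (2 * Real.pi / L * y) := rfl

/-- The gauge `1 - ∑ (1 - cos (2πxᵢ/L)) / δ²`. -/
def torusGauge (δ : ℝ) (x : Torus d L) : ℝ := 1 - (∑ i, (1 - circleCos L (x i))) / δ ^ 2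

/-- An unnormalised bump function on the torus of width comparable to `δ`. -/
def torusBump (δ : ℝ) (x : Torus d L) : ℝ := Real.smoothTransition (torusGauge δ x)

theorem torusSmooth_torusGauge (δ : ℝ) : TorusSmooth (torusGauge (d := d) (L := L) δ) := by
  unfold TorusSmooth torusGauge toTorus
  simp only [circleCos_coe]
  fun_prop

theorem torusSmooth_torusBump (δ : ℝ) : TorusSmooth (torusBump (d := d) (L := L) δ) :=
  Real.smoothTransition.contDiff.comp (torusSmooth_torusGauge (d := d) (L := L) δ)

theorem torusBump_neg (δ : ℝ) (x : Torus d L) : torusBump δ (-x) = torusBump δ x := by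
  obtain ⟨y, rfl⟩ := toTorus_isOpenQuotientMap.surjective x
  have h : ∀ i, circleCos L (toTorus d L (-y) i) = circleCos L (toTorus d L y i) := fun i => by
    simp only [toTorus, circleCos_coe, Pi.neg_apply, mul_neg, Real.cos_neg]
  simp only [← toTorus_neg, torusBump, torusGauge, h]

theorem norm_le_of_torusGauge_nonneg {δ : ℝ} (hδ : 0 < δ) {x : Torus d L}
    (hx : 0 ≤ torusGauge δ x) : ‖x‖ ≤ δ * L / 2 := by
  have hL0 := hL.out
  obtain ⟨y, rfl, -, hy⟩ := exists_toTorus_norm_eq x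
  refine (pi_norm_le_iff_of_nonneg (by positivity)).2 fun i => ?_
  rw [(hy i).2]
  have h1 : ∑ i, (1 - circleCos L (toTorus d L y i)) ≤ δ ^ 2 := by
    rw [torusGauge, sub_nonneg, div_le_one (by positivity)] at hx
    exact hx
  have h2 : 1 - Real.cos (2 * Real.pi / L * y i) ≤ δ ^ 2 :=
    (Finset.single_le_sum (f := fun i => 1 - circleCos L (toTorus d L y i))
      (fun j _ => sub_nonneg.2 (Real.cos_le_one _)) (Finset.mem_univ i)).trans h1
  have h3 : |2 * Real.pi / L * y i| ≤ Real.pi := by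
    rw [abs_mul, abs_of_pos (by positivity)]
    calc _ ≤ 2 * Real.pi / L * (L / 2) := by gcongr; exact (hy i).1
      _ = Real.pi := by field_simp
  have h4 := Real.cos_le_one_sub_mul_cos_sq h3
  have h5 : 2 / Real.pi ^ 2 * (2 * Real.pi / L * y i) ^ 2 = 8 * y i ^ 2 / L ^ 2 := by
    field_simp; ring
  have h6 : 8 * y i ^ 2 / L ^ 2 ≤ δ ^ 2 := by rw [← h5]; linarith
  rw [div_le_iff₀ (by positivity)] at h6
  have h7 : y i ^ 2 ≤ (δ * L / 2) ^ 2 := by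
    have : (δ * L / 2) ^ 2 = δ ^ 2 * L ^ 2 / 4 := by ring
    rw [this]
    linarith [sq_nonneg (y i)]
  exact abs_le_of_sq_le_sq h7 (by positivity)

theorem half_le_torusGauge {δ : ℝ} (hδ : 0 < δ) {x : Torus d L}
    (hx : ‖x‖ ≤ δ * (L / (2 * Real.pi * (d + 1)))) : 1 / 2 ≤ torusGauge δ x := by
  have hL0 := hL.out
  obtain ⟨y, rfl, -, hy⟩ := exists_toTorus_norm_eq x
  have h1 : ∀ i, 1 - circleCos L (toTorus d L y i) ≤ (δ / (d + 1)) ^ 2 / 2 := by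
    intro i
    have h2 : |2 * Real.pi / L * y i| ≤ δ / (d + 1) := by
      rw [abs_mul, abs_of_pos (by positivity), ← (hy i).2]
      calc _ ≤ 2 * Real.pi / L * (δ * (L / (2 * Real.pi * (d + 1)))) := by
            gcongr; exact (norm_le_pi_norm _ i).trans hx
        _ = _ := by field_simp
    have h3 := Real.one_sub_sq_div_two_le_cos (x := 2 * Real.pi / L * y i)
    have h4 : (2 * Real.pi / L * y i) ^ 2 ≤ (δ / (d + 1)) ^ 2 := sq_le_sq' (abs_le.1 h2).1 (abs_le.1 h2).2
    have : circleCos L (toTorus d L y i) = Real.cos (2 * Real.pi / L * y i) := rfl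
    linarith
  have h2 : ∑ i, (1 - circleCos L (toTorus d L y i)) ≤ δ ^ 2 / 2 := by
    refine (Finset.sum_le_sum fun i _ => h1 i).trans ?_
    rw [Finset.sum_const, Finset.card_univ, Fintype.card_fin, nsmul_eq_mul]
    have : (d : ℝ) * ((δ / (d + 1)) ^ 2 / 2) = (d / (d + 1) ^ 2) * (δ ^ 2 / 2) := by field_simp
    rw [this]
    refine mul_le_of_le_one_left (by positivity) ?_
    rw [div_le_one (by positivity)]
    nlinarith [(Nat.cast_nonneg d : (0 : ℝ) ≤ d)]
  have h3 : (∑ i, (1 - circleCos L (toTorus d L y i))) / δ ^ 2 ≤ 1 / 2 := by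
    rw [div_le_iff₀ (by positivity)]; linarith
  rw [torusGauge]; linarith

theorem exists_bound_deriv_smoothTransition :
    ∃ C, 0 ≤ C ∧ ∀ x, |deriv Real.smoothTransition x| ≤ C := by
  have hc : Continuous (deriv Real.smoothTransition) :=
    (Real.smoothTransition.contDiff (n := 1)).continuous_deriv le_rfl
  have hs : HasCompactSupport (deriv Real.smoothTransition) := by
    refine HasCompactSupport.intro (isCompact_Icc (a := (0 : ℝ)) (b := 1)) fun x hx => ?_
    rw [mem_Icc, not_and_or, not_le, not_le] at hx
    rcases hx with hx | hx
    · have : Real.smoothTransition =ᶠ[nhds x] fun _ => 0 :=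
        Filter.Eventually.mono (Iio_mem_nhds hx) fun y hy => Real.smoothTransition.zero_of_nonpos (le_of_lt hy)
      rw [this.deriv_eq, deriv_const]
    · have : Real.smoothTransition =ᶠ[nhds x] fun _ => 1 :=
        Filter.Eventually.mono (Ioi_mem_nhds hx) fun y hy => Real.smoothTransition.one_of_one_le (le_of_lt hy)
      rw [this.deriv_eq, deriv_const]
  obtain ⟨C, hC⟩ := hc.bounded_above_of_compact_support hs
  exact ⟨C, (abs_nonneg _).trans (hC 0), hC⟩

theorem deriv_smoothTransition_of_neg {x : ℝ} (hx : x < 0) : deriv Real.smoothTransition x = 0 := by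
  have : Real.smoothTransition =ᶠ[nhds x] fun _ => 0 :=
    Filter.Eventually.mono (Iio_mem_nhds hx) fun y hy => Real.smoothTransition.zero_of_nonpos (le_of_lt hy)
  rw [this.deriv_eq, deriv_const]

theorem torusPartial_torusBump (δ : ℝ) (i : Fin d) (y : Fin d → ℝ) :
    torusPartial i (torusBump (L := L) δ) (toTorus d L y) =
      deriv Real.smoothTransition (torusGauge δ (toTorus d L y)) *
        -(Real.sin (2 * Real.pi / L * y i) * (2 * Real.pi / L) / δ ^ 2) := by
  have hg : HasDerivAt (fun s : ℝ =>
      torusGauge δ (toTorus d L y + Pi.single i (s : AddCircle L)))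
      (-(Real.sin (2 * Real.pi / L * y i) * (2 * Real.pi / L) / δ ^ 2)) 0 := by
    have h1 : ∀ j, HasDerivAt (fun s : ℝ =>
        1 - circleCos L ((toTorus d L y + Pi.single i (s : AddCircle L) : Torus d L) j))
        (if j = i then Real.sin (2 * Real.pi / L * y i) * (2 * Real.pi / L) else 0) 0 := by
      intro j
      by_cases h : j = i
      · subst h
        have h2 : HasDerivAt (fun s : ℝ => 2 * Real.pi / L * (y j + s)) (2 * Real.pi / L) 0 := by
          simpa using ((hasDerivAt_id (0 : ℝ)).const_add (y j)).const_mul (2 * Real.pi / L)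
        have h3 := (h2.cos.const_sub 1)
        simp only [add_zero, neg_mul, neg_neg] at h3
        simp only [if_true]
        refine h3.congr_of_eventuallyEq (Filter.Eventually.of_forall fun s => ?_)
        simp only [Pi.add_apply, Pi.single_eq_same, toTorus, ← AddCircle.coe_add, circleCos_coe]
      · simp only [h, if_false, Pi.add_apply, ne_eq, not_false_eq_true, Pi.single_eq_of_ne, add_zero]
        exact hasDerivAt_const _ _
    have h2 := ((HasDerivAt.fun_sum fun j (_ : j ∈ Finset.univ) => h1 j).div_const (δ ^ 2)).const_sub 1
    simpa only [torusGauge, Finset.sum_ite_eq', Finset.mem_univ, if_true] using h2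
  have h0 : torusGauge δ (toTorus d L y + Pi.single i ((0 : ℝ) : AddCircle L)) =
      torusGauge δ (toTorus d L y) := by simp
  have h4 := (((Real.smoothTransition.contDiff (n := 1)).differentiable one_ne_zero)
    (torusGauge δ (toTorus d L y))).hasDerivAt
  rw [← h0] at h4
  have h5 := h4.comp (0 : ℝ) hg
  rw [h0] at h5
  exact h5.deriv

theorem norm_mul_torusPartial_torusBump_le {δ C : ℝ} (hδ : 0 < δ)
    (hC : ∀ x, |deriv Real.smoothTransition x| ≤ C) (i : Fin d) (x : Torus d L) :
    ‖x‖ * |torusPartial i (torusBump δ) x| ≤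
      (Metric.closedBall (0 : Torus d L) (δ * L / 2)).indicator (fun _ => C * Real.pi ^ 2) x := by
  have hL0 := hL.out
  have hC0 : 0 ≤ C := (abs_nonneg _).trans (hC 0)
  obtain ⟨y, rfl, -, hy⟩ := exists_toTorus_norm_eq x
  by_cases h : 0 ≤ torusGauge δ (toTorus d L y)
  · have h1 := norm_le_of_torusGauge_nonneg hδ h
    rw [indicator_of_mem (by simpa using h1), torusPartial_torusBump, abs_mul, abs_neg]
    have h2 : |Real.sin (2 * Real.pi / L * y i) * (2 * Real.pi / L) / δ ^ 2| ≤
        2 * Real.pi / L * (δ * L / 2) * (2 * Real.pi / L) / δ ^ 2 := by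
      rw [abs_div, abs_mul, abs_of_pos (by positivity : 0 < 2 * Real.pi / L),
        abs_of_pos (by positivity : 0 < δ ^ 2)]
      gcongr
      refine Real.abs_sin_le_abs.trans ?_
      rw [abs_mul, abs_of_pos (by positivity : 0 < 2 * Real.pi / L), ← (hy i).2]
      gcongr
      exact (norm_le_pi_norm _ i).trans h1
    calc _ ≤ (δ * L / 2) * (C * (2 * Real.pi / L * (δ * L / 2) * (2 * Real.pi / L) / δ ^ 2)) := by
          gcongr
          exact hC _
      _ = C * Real.pi ^ 2 := by field_simp; try ring
  · rw [torusPartial_torusBump, deriv_smoothTransition_of_neg (not_le.1 h)]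
    simp only [zero_mul, abs_zero, mul_zero]
    exact indicator_nonneg (fun _ _ => by positivity) _

theorem volume_torus_closedBall {r : ℝ} (hr : 0 ≤ r) (hr2 : 2 * r ≤ L) :
    volume.real (Metric.closedBall (0 : Torus d L) r) = (2 * r) ^ d := by
  rw [Measure.real, volume_pi_closedBall _ hr]
  simp [AddCircle.volume_closedBall, min_eq_right hr2, ENNReal.toReal_ofReal, hr]

theorem exists_isMollifier (d : ℕ) (L : ℝ) [hL : Fact (0 < L)] :
    ∃ C, 0 ≤ C ∧ ∀ r, 0 < r → ∃ k : Torus d L → ℝ, IsMollifier k r C := by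
  have hL0 := hL.out
  obtain ⟨C, hC0, hC⟩ := exists_bound_deriv_smoothTransition
  set c := Real.smoothTransition (1 / 2) with hc
  have hc0 : 0 < c := Real.smoothTransition.pos_of_pos (by norm_num)
  set R := L / (2 * Real.pi * (d + 1)) with hR
  have hR0 : 0 < R := by positivity
  have hRL : 2 * R ≤ L := by
    rw [hR, mul_div_assoc', div_le_iff₀ (by positivity)]
    have h1 : (1 : ℝ) ≤ Real.pi * (d + 1) := by
      nlinarith [Real.pi_gt_three, (Nat.cast_nonneg d : (0 : ℝ) ≤ d)]
    nlinarith
  refine ⟨(c * (2 * R) ^ d)⁻¹ * (C * Real.pi ^ 2 * L ^ d), by positivity, fun r hr => ?_⟩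
  set δ := min 1 (r / L) with hδ
  have hδ0 : 0 < δ := lt_min one_pos (by positivity)
  have hδ1 : δ ≤ 1 := min_le_left _ _
  have hδr : δ * L / 2 < r := by
    have : δ * L ≤ r := by
      rw [← le_div_iff₀ hL0]; exact min_le_right _ _
    linarith
  have hsm := torusSmooth_torusBump (d := d) (L := L) δ
  have hint : Integrable (torusBump (d := d) (L := L) δ) :=
    hsm.continuous.integrable_of_hasCompactSupport (HasCompactSupport.of_compactSpace _)
  set I := ∫ x : Torus d L, torusBump δ x with hI
  have hIle : c * (2 * R) ^ d * δ ^ d ≤ I := by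
    have h1 : ∫ x, (Metric.closedBall (0 : Torus d L) (δ * R)).indicator (fun _ => c) x ≤ I := by
      refine integral_mono ((integrable_const c).indicator Metric.isClosed_closedBall.measurableSet)
        hint fun x => indicator_apply_le' (fun hx => ?_) fun _ => Real.smoothTransition.nonneg _
      refine Real.smoothTransition.monotone (half_le_torusGauge hδ0 ?_)
      simpa using hx
    rw [integral_indicator_const _ Metric.isClosed_closedBall.measurableSet,
      volume_torus_closedBall (by positivity) (by nlinarith), smul_eq_mul] at h1
    calc _ = (2 * (δ * R)) ^ d * c := by rw [mul_left_comm, mul_pow δ]; ring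
      _ ≤ I := h1
  have hI0 : 0 < I := lt_of_lt_of_le (by positivity) hIle
  have hpart : ∀ i x, torusPartial i (fun x : Torus d L => I⁻¹ * torusBump δ x) x =
      I⁻¹ * torusPartial i (torusBump δ) x := fun i x => by
    simp only [torusPartial]
    exact deriv_const_mul_field _
  refine ⟨fun x => I⁻¹ * torusBump δ x, ⟨contDiff_const.mul hsm, fun x => by rw [torusBump_neg],
    fun x => mul_nonneg (by positivity) (Real.smoothTransition.nonneg _), ?_, fun x hx => ?_,
    fun i x hx => ?_, fun i => ?_⟩⟩
  · rw [integral_const_mul, inv_mul_cancel₀ hI0.ne']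
  · have : torusGauge δ x < 0 := by
      by_contra! h
      linarith [norm_le_of_torusGauge_nonneg hδ0 h]
    simp [torusBump, Real.smoothTransition.zero_of_nonpos this.le]
  · have : torusGauge δ x < 0 := by
      by_contra! h
      linarith [norm_le_of_torusGauge_nonneg hδ0 h]
    obtain ⟨y, rfl⟩ := toTorus_isOpenQuotientMap.surjective x
    rw [hpart, torusPartial_torusBump, deriv_smoothTransition_of_neg this]
    simp
  · have h1 : ∀ x : Torus d L, ‖x‖ * |torusPartial i (fun x : Torus d L => I⁻¹ * torusBump δ x) x| =
        I⁻¹ * (‖x‖ * |torusPartial i (torusBump δ) x|) := fun x => by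
      rw [hpart, abs_mul, abs_of_pos (inv_pos.2 hI0)]; ring
    simp only [h1]
    rw [integral_const_mul]
    have h2 : ∫ x : Torus d L, ‖x‖ * |torusPartial i (torusBump δ) x| ≤
        C * Real.pi ^ 2 * L ^ d * δ ^ d := by
      calc _ ≤ ∫ x, (Metric.closedBall (0 : Torus d L) (δ * L / 2)).indicator
            (fun _ => C * Real.pi ^ 2) x := by
            refine integral_mono_of_nonneg (ae_of_all _ fun x => by positivity)
              ((integrable_const _).indicator Metric.isClosed_closedBall.measurableSet)
              (ae_of_all _ fun x => norm_mul_torusPartial_torusBump_le hδ0 hC i x)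
        _ = _ := by
            rw [integral_indicator_const _ Metric.isClosed_closedBall.measurableSet,
              volume_torus_closedBall (by positivity) (by nlinarith), smul_eq_mul,
              mul_div_cancel₀ _ two_ne_zero, mul_pow]
            ring
    calc _ ≤ (c * (2 * R) ^ d * δ ^ d)⁻¹ * (C * Real.pi ^ 2 * L ^ d * δ ^ d) := by
          gcongr
      _ = _ := by
          have : δ ^ d ≠ 0 := by positivity
          field_simp

end

section

theorem norm_toLp_two_sq {α E : Type*} [MeasurableSpace α] {μ : Measure α} [NormedAddCommGroup E]
    [InnerProductSpace ℝ E] {g : α → E} (hg : MemLp g 2 μ) :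
    ‖hg.toLp g‖ ^ 2 = ∫ x, ‖g x‖ ^ 2 ∂μ := by
  rw [← real_inner_self_eq_norm_sq, L2.inner_def]
  refine integral_congr_ae (hg.coeFn_toLp.mono fun x hx => ?_)
  simp only [hx, real_inner_self_eq_norm_sq]

theorem MemLp.integrable_norm_sq {α E : Type*} [MeasurableSpace α] {μ : Measure α}
    [NormedAddCommGroup E] {g : α → E} (hg : MemLp g 2 μ) : Integrable (fun x => ‖g x‖ ^ 2) μ :=
  hg.norm.integrable_sq

variable {d : ℕ} {L : ℝ} [Fact (0 < L)]

theorem measurePreserving_sub_right_torus (z : Torus d L) :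
    MeasurePreserving (fun x : Torus d L => x - z) volume volume :=
  measurePreserving_sub_right volume z

theorem continuous_shift_toLp {F : Type*} [NormedAddCommGroup F] {p : ℝ≥0∞} [Fact (1 ≤ p)]
    (hp : p ≠ ⊤) {f : Torus d L → F} (hf : MemLp f p) :
    Continuous fun z : Torus d L =>
      (hf.comp_measurePreserving (measurePreserving_sub_right_torus z)).toLp := by
  have hc : Continuous (fun p : Torus d L × Torus d L => p.2 - p.1) :=
    continuous_snd.sub continuous_fst
  exact Continuous.compMeasurePreservingLp (f := fun _ : Torus d L => hf.toLp f)
    continuous_const (ContinuousMap.curry ⟨_, hc⟩).continuous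
    (fun z => measurePreserving_sub_right_torus z) hp

theorem exists_dist_shift_lt {F : Type*} [NormedAddCommGroup F] {p : ℝ≥0∞} [Fact (1 ≤ p)]
    (hp : p ≠ ⊤) {f : Torus d L → F} (hf : MemLp f p) {ε : ℝ} (hε : 0 < ε) :
    ∃ δ > 0, ∀ z : Torus d L, ‖z‖ ≤ δ →
      ‖(hf.sub (hf.comp_measurePreserving (measurePreserving_sub_right_torus z))).toLp‖ < ε := by
  have h := (continuous_shift_toLp hp hf).continuousAt (x := 0)
  obtain ⟨δ, hδ, h⟩ := Metric.continuousAt_iff.1 h ε hε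
  refine ⟨δ / 2, by positivity, fun z hz => ?_⟩
  have := h (x := z) (by rw [dist_zero_right]; linarith)
  rw [dist_comm, dist_eq_norm, ← MemLp.toLp_sub] at this
  simpa only [sub_zero, Function.comp_def] using this

theorem exists_integral_norm_sq_shift_le {E : Type*} [NormedAddCommGroup E] [InnerProductSpace ℝ E]
    {f : Torus d L → E} (hf : MemLp f 2) {ε : ℝ} (hε : 0 < ε) :
    ∃ δ > 0, ∀ z : Torus d L, ‖z‖ ≤ δ → ∫ x, ‖f x - f (x - z)‖ ^ 2 ≤ ε := by
  obtain ⟨δ, hδ, h⟩ := exists_dist_shift_lt (by simp) hf (Real.sqrt_pos.2 hε)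
  refine ⟨δ, hδ, fun z hz => ?_⟩
  have h1 := norm_toLp_two_sq
    (hf.sub (hf.comp_measurePreserving (measurePreserving_sub_right_torus z)))
  have h2 := h z hz
  simp only [Pi.sub_apply, Function.comp_apply] at h1
  rw [← h1, ← Real.sq_sqrt hε.le]
  gcongr

theorem exists_integral_norm_shift_le {F : Type*} [NormedAddCommGroup F]
    {f : Torus d L → F} (hf : Integrable f) {ε : ℝ} (hε : 0 < ε) :
    ∃ δ > 0, ∀ z : Torus d L, ‖z‖ ≤ δ → ∫ x, ‖f x - f (x - z)‖ ≤ ε := by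
  have hf' : MemLp f 1 := memLp_one_iff_integrable.2 hf
  obtain ⟨δ, hδ, h⟩ := exists_dist_shift_lt (by simp) hf' hε
  refine ⟨δ, hδ, fun z hz => le_of_eq_of_le ?_ (h z hz).le⟩
  rw [Lp.norm_toLp, eLpNorm_one_eq_lintegral_enorm, integral_norm_eq_lintegral_enorm]
  · rfl
  · exact (hf'.sub (hf'.comp_measurePreserving (measurePreserving_sub_right_torus z))).1

theorem integral_integral_kernel_mul_le {κ : Torus d L → ℝ} {H : Torus d L → Torus d L → ℝ}
    {r C ε : ℝ} (hκ : Integrable κ) (hκ0 : ∀ x, 0 ≤ κ x) (hκC : ∫ x, κ x ≤ C)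
    (hκr : ∀ x, r < ‖x‖ → κ x = 0) (hε : 0 ≤ ε)
    (hH : Integrable (fun p : Torus d L × Torus d L => κ (p.1 - p.2) * H p.1 p.2)
      (volume.prod volume))
    (hHε : ∀ z, ‖z‖ ≤ r → ∫ x, H x (x - z) ≤ ε) :
    ∫ x, ∫ y, κ (x - y) * H x y ≤ C * ε := by
  have hΦ : MeasurePreserving (fun p : Torus d L × Torus d L => (p.1, p.1 - p.2))
      (volume.prod volume) (volume.prod volume) := by
    have h1 : MeasurePreserving (fun p : Torus d L × Torus d L => (p.1, -p.2))
      (volume.prod volume) (volume.prod volume) :=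
      (MeasurePreserving.id _).prod (Measure.measurePreserving_neg volume)
    have h2 := (measurePreserving_prod_add (volume : Measure (Torus d L)) volume).comp h1
    simpa [Function.comp_def, sub_eq_add_neg] using h2
  have hint := hΦ.integrable_comp_of_integrable hH
  simp only [Function.comp_def, sub_sub_cancel] at hint
  calc ∫ x, ∫ y, κ (x - y) * H x y = ∫ x, ∫ z, κ z * H x (x - z) := by
        congr 1; ext x
        rw [← integral_sub_left_eq_self _ volume x]
        simp
    _ = ∫ z, ∫ x, κ z * H x (x - z) := integral_integral_swap hint
    _ = ∫ z, κ z * ∫ x, H x (x - z) := by simp only [integral_const_mul]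
    _ ≤ ∫ z, κ z * ε := by
        refine integral_mono_ae ?_ (hκ.mul_const ε) (ae_of_all _ fun z => ?_)
        · have := hint.swap.integral_prod_left
          simpa only [Function.comp_def, Prod.swap, integral_const_mul] using this
        · by_cases hz : ‖z‖ ≤ r
          · exact mul_le_mul_of_nonneg_left (hHε z hz) (hκ0 z)
          · simp [hκr z (not_le.1 hz)]
    _ ≤ C * ε := by
        rw [integral_mul_const]
        gcongr

theorem integrable_norm_sub_sq_prod {E : Type*} [NormedAddCommGroup E] [InnerProductSpace ℝ E]
    {f : Torus d L → E} (hf : MemLp f 2) :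
    Integrable (fun p : Torus d L × Torus d L => ‖f p.1 - f p.2‖ ^ 2) (volume.prod volume) := by
  have h1 : MemLp (fun p : Torus d L × Torus d L => f p.1) 2 (volume.prod volume) :=
    hf.comp_fst _
  have h2 : MemLp (fun p : Torus d L × Torus d L => f p.2) 2 (volume.prod volume) :=
    hf.comp_snd _
  exact MemLp.integrable_norm_sq (h1.sub h2)

theorem integrable_kernel_mul_prod {κ : Torus d L → ℝ} (hκ : Continuous κ)
    {H : Torus d L → Torus d L → ℝ}
    (hH : Integrable (fun p : Torus d L × Torus d L => H p.1 p.2) (volume.prod volume)) :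
    Integrable (fun p : Torus d L × Torus d L => κ (p.1 - p.2) * H p.1 p.2)
      (volume.prod volume) := by
  obtain ⟨C, hC⟩ := isCompact_univ.exists_bound_of_continuousOn hκ.continuousOn
  exact hH.bdd_mul (hκ.comp (continuous_fst.sub continuous_snd)).aestronglyMeasurable
    (ae_of_all _ fun p => hC _ trivial)

end

section

variable {d : ℕ} {L : ℝ} [Fact (0 < L)]

theorem TorusSmooth.integrable {F : Type*} [NormedAddCommGroup F] [NormedSpace ℝ F]
    {f : Torus d L → F} (hf : TorusSmooth f) : Integrable f :=
  hf.continuous.integrable_of_hasCompactSupport (HasCompactSupport.of_compactSpace _)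

theorem IsMollifier.integrable {k : Torus d L → ℝ} {r C : ℝ} (hk : IsMollifier k r C) :
    Integrable k :=
  hk.smooth.integrable

theorem IsMollifier.integral_comp_sub {k : Torus d L → ℝ} {r C : ℝ} (hk : IsMollifier k r C)
    (x : Torus d L) : ∫ y, k (x - y) = 1 := by
  rw [integral_sub_left_eq_self k volume x, hk.integral_eq_one]

theorem norm_torusPartial_mollify_le {k : Torus d L → ℝ} {r C : ℝ} (hk : IsMollifier k r C)
    {U G : Torus d L → EuclideanSpace ℝ (Fin d)} (hU : Integrable U) {i : Fin d}
    (hG : IsWeakPartial i U G) {A : ℝ} (hA : ∀ᵐ x, ‖G x‖ ≤ A) (x : Torus d L) :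
    ‖torusPartial i (torusConv k U) x‖ ≤ A := by
  have h1 := hG (fun y => k (x - y)) (hk.smooth.comp_sub_left x)
  simp only [torusPartial_comp_sub_left, neg_smul, integral_neg, neg_inj] at h1
  rw [torusPartial_torusConv hk.smooth hU, torusConv, h1]
  calc _ ≤ ∫ y, k (x - y) * A := by
        refine norm_integral_le_of_norm_le ((hk.integrable.comp_sub_left x).mul_const A)
          (hA.mono fun y hy => ?_)
        rw [norm_smul, Real.norm_of_nonneg (hk.nonneg _)]
        exact mul_le_mul_of_nonneg_left hy (hk.nonneg _)
    _ = A := by rw [integral_mul_const, hk.integral_comp_sub, one_mul]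

theorem IsMollifier.integral_norm_sub_torusConv_le {F : Type*} [NormedAddCommGroup F]
    [NormedSpace ℝ F] [CompleteSpace F] {k : Torus d L → ℝ} {r C : ℝ} (hk : IsMollifier k r C)
    {U : Torus d L → F} (hU : Integrable U) {ε : ℝ} (hε : 0 ≤ ε)
    (hr : ∀ z, ‖z‖ ≤ r → ∫ x, ‖U x - U (x - z)‖ ≤ ε) :
    ∫ x, ‖torusConv k U x - U x‖ ≤ ε := by
  have hint : Integrable (fun p : Torus d L × Torus d L => k (p.1 - p.2) * ‖U p.1 - U p.2‖)
      (volume.prod volume) :=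
    integrable_kernel_mul_prod (H := fun x y => ‖U x - U y‖) hk.smooth.continuous
      ((hU.comp_fst _).sub (hU.comp_snd _)).norm
  have h := integral_integral_kernel_mul_le (H := fun x y => ‖U x - U y‖) hk.integrable hk.nonneg
    hk.integral_eq_one.le hk.eq_zero hε hint hr
  rw [one_mul] at h
  refine le_trans (integral_mono_ae ?_ hint.integral_prod_left (ae_of_all _ fun x => ?_)) h
  · exact ((hk.smooth.conv hU).integrable.sub hU).norm
  · have h1 : U x = ∫ y, k (x - y) • U x := by
      rw [integral_smul_const, hk.integral_comp_sub, one_smul]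
    have h2 : torusConv k U x - U x = ∫ y, k (x - y) • (U y - U x) := by
      conv_lhs => rw [h1]
      simp only [smul_sub]
      rw [integral_sub (integrable_kernel_smul hk.smooth hU x)
        ((hk.integrable.comp_sub_left x).smul_const _)]
      rfl
    simp only [h2]
    refine (norm_integral_le_integral_norm _).trans (le_of_eq (integral_congr_ae
      (ae_of_all _ fun y => ?_)))
    simp only [norm_smul, Real.norm_of_nonneg (hk.nonneg _), norm_sub_rev (U x)]

/-- A function with bounded weak gradient is Lipschitz off a null set. -/
theorem exists_lipschitz_set_of_isWeakPartial
    {U : Torus d L → EuclideanSpace ℝ (Fin d)} {G : Fin d → Torus d L → EuclideanSpace ℝ (Fin d)}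
    (hU : Integrable U) (hG : ∀ i, IsWeakPartial i U (G i)) {A : Fin d → ℝ}
    (hA : ∀ i, ∀ᵐ x, ‖G i x‖ ≤ A i) :
    ∃ s : Set (Torus d L), (∀ᵐ x, x ∈ s) ∧
      ∀ x ∈ s, ∀ y ∈ s, ‖U x - U y‖ ≤ (∑ i, A i) * ‖x - y‖ := by
  obtain ⟨C, -, hC⟩ := exists_isMollifier d L
  choose k hk using fun n : ℕ => hC (1 / ((n : ℝ) + 1)) (by positivity)
  have hconv : Filter.Tendsto (fun n => ∫ x, ‖torusConv (k n) U x - U x‖) Filter.atTop (nhds 0) := by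
    refine Metric.tendsto_atTop.2 fun ε hε => ?_
    obtain ⟨δ, hδ, h⟩ := exists_integral_norm_shift_le hU (half_pos hε)
    obtain ⟨N, hN⟩ := exists_nat_one_div_lt hδ
    refine ⟨N, fun n hn => ?_⟩
    rw [dist_zero_right, Real.norm_of_nonneg (integral_nonneg fun x => norm_nonneg _)]
    refine lt_of_le_of_lt ((hk n).integral_norm_sub_torusConv_le hU (half_pos hε).le fun z hz =>
      h z (hz.trans ?_)) (half_lt_self hε)
    exact (Nat.one_div_le_one_div hn).trans hN.le
  have hLp : Filter.Tendsto (fun n => eLpNorm (torusConv (k n) U - U) 1 volume) Filter.atTop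
      (nhds 0) := by
    have h1 : ∀ n, eLpNorm (torusConv (k n) U - U) 1 volume =
        ENNReal.ofReal (∫ x, ‖torusConv (k n) U x - U x‖) := fun n => by
      rw [eLpNorm_one_eq_lintegral_enorm, ← ofReal_integral_norm_eq_lintegral_enorm]
      · rfl
      · exact ((hk n).smooth.conv hU).integrable.sub hU
    simp only [h1]
    simpa using ENNReal.tendsto_ofReal hconv
  obtain ⟨ns, -, hns⟩ := (tendstoInMeasure_of_tendsto_eLpNorm one_ne_zero
    (fun n => ((hk n).smooth.conv hU).integrable.aestronglyMeasurable) hU.aestronglyMeasurable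
    hLp).exists_seq_tendsto_ae
  refine ⟨{x | Filter.Tendsto (fun n => torusConv (k (ns n)) U x) Filter.atTop (nhds (U x))}, hns,
    fun x hx y hy => ?_⟩
  refine le_of_tendsto (Filter.Tendsto.sub hx hy).norm (Filter.Eventually.of_forall fun n => ?_)
  exact ((hk (ns n)).smooth.conv hU).norm_sub_le (fun x => Finset.sum_le_sum fun i _ =>
    norm_torusPartial_mollify_le (hk (ns n)) hU (hG i) (hA i) x) x y

end

section

theorem integral_half_add_sub {α : Type*} [MeasurableSpace α] {μ : Measure α} {a b c : α → ℝ}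
    (ha : Integrable a μ) (hb : Integrable b μ) (hc : Integrable c μ) :
    ∫ x, (a x + b x - c x) / 2 ∂μ = ((∫ x, a x ∂μ) + (∫ x, b x ∂μ) - ∫ x, c x ∂μ) / 2 := by
  rw [integral_div, integral_sub (f := fun x => a x + b x) (ha.add hb) hc, integral_add ha hb]

variable {d : ℕ} {L : ℝ}

theorem torusPartial_neg_of_even {k : Torus d L → ℝ} (hk : ∀ x, k (-x) = k x) (i : Fin d)
    (x : Torus d L) : torusPartial i k (-x) = -torusPartial i k x := by
  have h := torusPartial_comp_neg i k x
  simp only [hk] at h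
  rw [h, neg_neg]

theorem continuous_torusPartial {k : Torus d L → ℝ} (hk : TorusSmooth k) (i : Fin d) :
    Continuous (torusPartial i k) :=
  (hk.torusPartial i).continuous

variable [Fact (0 < L)]

theorem integral_torusPartial_of_even {k : Torus d L → ℝ} (hk : ∀ x, k (-x) = k x) (i : Fin d) :
    ∫ x, torusPartial i k x = 0 := by
  have h := integral_neg_eq_self (torusPartial i k) volume
  simp only [torusPartial_neg_of_even hk, integral_neg] at h
  linarith

/-- The commutator identity: for divergence-free `U` and even `k`, the transport term of the
mollified energy only sees differences of `w`. -/
theorem four_mul_integral_inner_transport_eq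
    {U w : Torus d L → EuclideanSpace ℝ (Fin d)} {k : Torus d L → ℝ} {m : ℝ}
    (hU : Measurable U) (hUm : ∀ x, ‖U x‖ ≤ m) (hUdiv : IsWeaklyDivFree U) (hw : MemLp w 2)
    (hk : TorusSmooth k) (hkeven : ∀ x, k (-x) = k x) :
    4 * ∫ x, inner ℝ (w x) (∑ i, U x i • torusConv (torusPartial i k) w x) =
      -∫ p : Torus d L × Torus d L, (∑ i, (U p.1 i - U p.2 i) * torusPartial i k (p.1 - p.2)) *
        ‖w p.1 - w p.2‖ ^ 2 := by
  have hwi : Integrable w := hw.integrable (by norm_num)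
  choose c hc0 hc using fun i => (hk.torusPartial i).exists_bound
  have hm0 : 0 ≤ m := (norm_nonneg _).trans (hUm 0)
  have hUi : ∀ i x, ‖U x i‖ ≤ m := fun i x => (PiLp.norm_apply_le (U x) i).trans (hUm x)
  have hUmeas : ∀ i, Measurable fun x => U x i := fun i => by fun_prop
  have hkc : ∀ i, Measurable fun p : Torus d L × Torus d L => torusPartial i k (p.1 - p.2) :=
    fun i => ((continuous_torusPartial hk i).comp (continuous_fst.sub continuous_snd)).measurable
  set D0 : Torus d L × Torus d L → ℝ := fun p => ∑ i, U p.1 i * torusPartial i k (p.1 - p.2) with hD0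
  set D : Torus d L × Torus d L → ℝ :=
    fun p => ∑ i, (U p.1 i - U p.2 i) * torusPartial i k (p.1 - p.2) with hD
  have hD0m : Measurable D0 := Finset.measurable_fun_sum _ fun i _ =>
    ((hUmeas i).comp measurable_fst).mul (hkc i)
  have hDm : Measurable D := Finset.measurable_fun_sum _ fun i _ =>
    (((hUmeas i).comp measurable_fst).sub ((hUmeas i).comp measurable_snd)).mul (hkc i)
  have hD0b : ∀ p, ‖D0 p‖ ≤ ∑ i, m * c i := fun p => (norm_sum_le _ _).trans
    (Finset.sum_le_sum fun i _ => by
      rw [norm_mul]; exact mul_le_mul (hUi i _) (hc i _) (norm_nonneg _) hm0)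
  have hDb : ∀ p, ‖D p‖ ≤ ∑ i, (m + m) * c i := fun p => (norm_sum_le _ _).trans
    (Finset.sum_le_sum fun i _ => by
      rw [norm_mul]
      exact mul_le_mul ((norm_sub_le _ _).trans (add_le_add (hUi i _) (hUi i _))) (hc i _)
        (norm_nonneg _) (by positivity))
  have hDD0 : ∀ p, D p = D0 p + D0 p.swap := fun p => by
    simp only [hD, hD0, ← Finset.sum_add_distrib, Prod.fst_swap, Prod.snd_swap]
    refine Finset.sum_congr rfl fun i _ => ?_
    rw [← neg_sub p.1 p.2, torusPartial_neg_of_even hkeven]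
    ring
  have hDswap : ∀ p, D p.swap = D p := fun p => by rw [hDD0, hDD0, Prod.swap_swap, add_comm]
  have hw1 : MemLp (fun p : Torus d L × Torus d L => w p.1) 2 (volume.prod volume) := hw.comp_fst _
  have hw2 : MemLp (fun p : Torus d L × Torus d L => w p.2) 2 (volume.prod volume) := hw.comp_snd _
  have hinner : Integrable (fun p : Torus d L × Torus d L => inner ℝ (w p.1) (w p.2))
      (volume.prod volume) := by
    refine (hwi.norm.mul_prod hwi.norm).mono' (hw1.1.inner hw2.1)
      (ae_of_all _ fun p => norm_inner_le_norm _ _)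
  have hI0 : Integrable (fun p => D0 p * inner ℝ (w p.1) (w p.2)) (volume.prod volume) :=
    hinner.bdd_mul hD0m.aestronglyMeasurable (ae_of_all _ hD0b)
  have hDint : ∀ {f : Torus d L × Torus d L → ℝ}, Integrable f (volume.prod volume) →
      Integrable (fun p => D p * f p) (volume.prod volume) := fun hf =>
    hf.bdd_mul hDm.aestronglyMeasurable (ae_of_all _ hDb)
  have hswapint : ∀ f : Torus d L × Torus d L → ℝ,
      ∫ p, f p.swap ∂(volume.prod volume) = ∫ p, f p ∂(volume.prod volume) :=
    fun f => integral_prod_swap f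
  have hg : ∫ x, inner ℝ (w x) (∑ i, U x i • torusConv (torusPartial i k) w x) =
      ∫ p, D0 p * inner ℝ (w p.1) (w p.2) ∂(volume.prod volume) := by
    rw [integral_prod _ hI0]
    refine integral_congr_ae (ae_of_all _ fun x => ?_)
    have hi : ∀ i, Integrable (fun y => U x i • torusPartial i k (x - y) • w y) := fun i =>
      (integrable_kernel_smul (hk.torusPartial i) hwi x).smul (U x i)
    simp only [hD0, torusConv, ← integral_smul]
    rw [← integral_finsetSum _ fun i _ => hi i,
      ← integral_inner (integrable_finsetSum _ fun i _ => hi i)]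
    refine integral_congr_ae (ae_of_all _ fun y => ?_)
    simp only [inner_sum, inner_smul_right, Finset.sum_mul, mul_assoc]
  have h2g : 2 * ∫ p, D0 p * inner ℝ (w p.1) (w p.2) ∂(volume.prod volume) =
      ∫ p, D p * inner ℝ (w p.1) (w p.2) ∂(volume.prod volume) := by
    have h1 : ∫ p, D0 p.swap * inner ℝ (w p.1) (w p.2) ∂(volume.prod volume) =
        ∫ p, D0 p * inner ℝ (w p.1) (w p.2) ∂(volume.prod volume) := by
      rw [← hswapint]
      refine integral_congr_ae (ae_of_all _ fun p => ?_)
      simp only [Prod.swap_swap, Prod.fst_swap, Prod.snd_swap, real_inner_comm]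
    have h2 : Integrable (fun p : Torus d L × Torus d L => D0 p.swap * inner ℝ (w p.1) (w p.2))
        (volume.prod volume) :=
      hinner.bdd_mul (hD0m.comp measurable_swap).aestronglyMeasurable
        (ae_of_all _ fun p => hD0b p.swap)
    simp only [hDD0, add_mul]
    rw [integral_add hI0 h2, h1]
    ring
  have hsq1 := MemLp.integrable_norm_sq hw1
  have hsq2 := MemLp.integrable_norm_sq hw2
  have hsq := integrable_norm_sub_sq_prod hw
  have hDy : ∀ x, ∫ y, D (x, y) = 0 := fun x => by
    have h1 := hUdiv (fun y => k (x - y)) (hk.comp_sub_left x)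
    simp only [torusPartial_comp_sub_left, mul_neg, Finset.sum_neg_distrib, integral_neg,
      neg_eq_zero] at h1
    have hp : ∀ i, Measurable fun y => torusPartial i k (x - y) := fun i =>
      ((continuous_torusPartial hk i).comp (continuous_const.sub continuous_id)).measurable
    have hpi : ∀ i, Integrable fun y => torusPartial i k (x - y) := fun i =>
      (hk.torusPartial i).integrable.comp_sub_left x
    have h2 : Integrable fun y => ∑ i, U x i * torusPartial i k (x - y) :=
      integrable_finsetSum _ fun i _ => (hpi i).const_mul _
    have h3 : Integrable fun y => ∑ i, U y i * torusPartial i k (x - y) :=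
      integrable_finsetSum _ fun i _ => (hpi i).bdd_mul (hUmeas i).aestronglyMeasurable
        (ae_of_all _ (hUi i))
    simp only [hD, sub_mul, Finset.sum_sub_distrib]
    rw [integral_sub h2 h3, h1, sub_zero,
      integral_finsetSum _ fun i _ => (hpi i).const_mul _]
    refine Finset.sum_eq_zero fun i _ => ?_
    rw [integral_const_mul, integral_sub_left_eq_self (torusPartial i k) volume x,
      integral_torusPartial_of_even hkeven, mul_zero]
  have hz1 : ∫ p, D p * ‖w p.1‖ ^ 2 ∂(volume.prod volume) = 0 := by
    rw [integral_prod _ (hDint hsq1)]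
    simp only [integral_mul_const, hDy, zero_mul, integral_zero]
  have hz2 : ∫ p, D p * ‖w p.2‖ ^ 2 ∂(volume.prod volume) = 0 := by
    rw [← hz1, ← hswapint]
    simp only [hDswap, Prod.snd_swap]
  have hpol : ∀ p : Torus d L × Torus d L, D p * inner ℝ (w p.1) (w p.2) =
      (D p * ‖w p.1‖ ^ 2 + D p * ‖w p.2‖ ^ 2 - D p * ‖w p.1 - w p.2‖ ^ 2) / 2 := fun p => by
    rw [norm_sub_sq_real]; ring
  have hfin : 2 * ∫ p, D p * inner ℝ (w p.1) (w p.2) ∂(volume.prod volume) =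
      -∫ p, D p * ‖w p.1 - w p.2‖ ^ 2 ∂(volume.prod volume) := by
    simp only [hpol]
    rw [integral_half_add_sub (hDint hsq1) (hDint hsq2) (hDint hsq), hz1, hz2]
    ring
  rw [hg, show (volume : Measure (Torus d L × Torus d L)) = volume.prod volume from rfl, ← hfin,
    ← h2g]
  ring

theorem abs_integral_inner_transport_le
    {U w : Torus d L → EuclideanSpace ℝ (Fin d)} {k : Torus d L → ℝ} {m r C ℓ ε : ℝ}
    (hU : Measurable U) (hUm : ∀ x, ‖U x‖ ≤ m) (hUdiv : IsWeaklyDivFree U) (hw : MemLp w 2)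
    {s : Set (Torus d L)} (hs : ∀ᵐ x, x ∈ s) (hℓ0 : 0 ≤ ℓ)
    (hℓ : ∀ x ∈ s, ∀ y ∈ s, ‖U x - U y‖ ≤ ℓ * ‖x - y‖) (hk : IsMollifier k r C) (hε : 0 ≤ ε)
    (hr : ∀ z, ‖z‖ ≤ r → ∫ x, ‖w x - w (x - z)‖ ^ 2 ≤ ε) :
    |∫ x, inner ℝ (w x) (∑ i, U x i • torusConv (torusPartial i k) w x)| ≤ ℓ * (d * C * ε) := by
  set κ : Torus d L → ℝ := fun z => ∑ i, ‖z‖ * |torusPartial i k z| with hκ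
  have hκi : ∀ i, Continuous fun z : Torus d L => ‖z‖ * |torusPartial i k z| := fun i =>
    continuous_norm.mul (continuous_torusPartial hk.smooth i).abs
  have hκc : Continuous κ := continuous_finsetSum _ fun i _ => hκi i
  have hκint : ∀ {f : Torus d L → ℝ}, Continuous f → Integrable f := fun hf =>
    hf.integrable_of_hasCompactSupport (HasCompactSupport.of_compactSpace _)
  have hsq := integrable_norm_sub_sq_prod hw
  have hint := integrable_kernel_mul_prod (H := fun x y => ‖w x - w y‖ ^ 2) hκc hsq
  have hle := integral_integral_kernel_mul_le (C := d * C) (H := fun x y => ‖w x - w y‖ ^ 2)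
    (hκint hκc) (fun x => Finset.sum_nonneg fun i _ => by positivity) (by
      simp only [hκ]
      rw [integral_finsetSum _ fun i _ => hκint (hκi i)]
      refine (Finset.sum_le_sum fun i _ => hk.moment_le i).trans (le_of_eq ?_)
      simp) (fun x hx => Finset.sum_eq_zero fun i _ => by simp [hk.partial_eq_zero i x hx]) hε
      hint hr
  have h4 := four_mul_integral_inner_transport_eq hU hUm hUdiv hw hk.smooth hk.even
  have hb : |∫ p : Torus d L × Torus d L, (∑ i, (U p.1 i - U p.2 i) *
      torusPartial i k (p.1 - p.2)) * ‖w p.1 - w p.2‖ ^ 2| ≤ ℓ * (d * C * ε) := by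
    rw [← Real.norm_eq_abs]
    refine (norm_integral_le_of_norm_le (hint.const_mul ℓ) ?_).trans ?_
    · have h1 : ∀ᵐ p : Torus d L × Torus d L ∂(volume.prod volume), p.1 ∈ s :=
        Measure.quasiMeasurePreserving_fst.ae hs
      have h2 : ∀ᵐ p : Torus d L × Torus d L ∂(volume.prod volume), p.2 ∈ s :=
        Measure.quasiMeasurePreserving_snd.ae hs
      filter_upwards [h1, h2] with p hp1 hp2
      rw [norm_mul, Real.norm_of_nonneg (sq_nonneg ‖w p.1 - w p.2‖), ← mul_assoc]
      refine mul_le_mul_of_nonneg_right ?_ (sq_nonneg _)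
      rw [hκ, Finset.mul_sum]
      refine (norm_sum_le _ _).trans (Finset.sum_le_sum fun i _ => ?_)
      rw [norm_mul, ← mul_assoc]
      refine mul_le_mul_of_nonneg_right ?_ (norm_nonneg _)
      exact (PiLp.norm_apply_le (U p.1 - U p.2) i).trans (hℓ _ hp1 _ hp2)
    · rw [integral_const_mul, integral_prod _ hint]
      exact mul_le_mul_of_nonneg_left hle hℓ0
  have h5 : 4 * |∫ x, inner ℝ (w x) (∑ i, U x i • torusConv (torusPartial i k) w x)| ≤
      ℓ * (d * C * ε) := by
    rw [← abs_of_pos (by norm_num : (0 : ℝ) < 4), ← abs_mul, h4, abs_neg]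
    exact hb
  linarith [abs_nonneg (∫ x, inner ℝ (w x) (∑ i, U x i • torusConv (torusPartial i k) w x))]

/-- The mollified energy converges to the energy. -/
theorem abs_integral_norm_sq_sub_integral_inner_conv_le
    {w : Torus d L → EuclideanSpace ℝ (Fin d)} {k : Torus d L → ℝ} {r C ε : ℝ}
    (hw : MemLp w 2) (hk : IsMollifier k r C) (hε : 0 ≤ ε)
    (hr : ∀ z, ‖z‖ ≤ r → ∫ x, ‖w x - w (x - z)‖ ^ 2 ≤ ε) :
    |(∫ x, ‖w x‖ ^ 2) - ∫ x, inner ℝ (w x) (torusConv k w x)| ≤ ε := by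
  have hwi : Integrable w := hw.integrable (by norm_num)
  have hsq := integrable_norm_sub_sq_prod hw
  have hw1 : MemLp (fun p : Torus d L × Torus d L => w p.1) 2 (volume.prod volume) := hw.comp_fst _
  have hw2 : MemLp (fun p : Torus d L × Torus d L => w p.2) 2 (volume.prod volume) := hw.comp_snd _
  have hkc := hk.smooth.continuous
  have hint := integrable_kernel_mul_prod (H := fun x y => ‖w x - w y‖ ^ 2) hkc hsq
  have hint1 := integrable_kernel_mul_prod (H := fun x y => ‖w x‖ ^ 2) hkc
    (MemLp.integrable_norm_sq hw1)
  have hint2 := integrable_kernel_mul_prod (H := fun x y => ‖w y‖ ^ 2) hkc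
    (MemLp.integrable_norm_sq hw2)
  have hle := integral_integral_kernel_mul_le (H := fun x y => ‖w x - w y‖ ^ 2) hk.integrable
    hk.nonneg hk.integral_eq_one.le hk.eq_zero hε hint hr
  have h1 : ∫ p : Torus d L × Torus d L, k (p.1 - p.2) * ‖w p.1‖ ^ 2 = ∫ x, ‖w x‖ ^ 2 := by
    rw [show (volume : Measure (Torus d L × Torus d L)) = volume.prod volume from rfl,
      integral_prod _ hint1]
    simp only [integral_mul_const, hk.integral_comp_sub, one_mul]
  have h2 : ∫ p : Torus d L × Torus d L, k (p.1 - p.2) * ‖w p.2‖ ^ 2 = ∫ x, ‖w x‖ ^ 2 := by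
    rw [← h1, show (volume : Measure (Torus d L × Torus d L)) = volume.prod volume from rfl,
      ← integral_prod_swap]
    congr 1; ext p
    rw [Prod.fst_swap, Prod.snd_swap, ← hk.even, neg_sub]
  have h3 : ∫ x, inner ℝ (w x) (torusConv k w x) = ∫ p : Torus d L × Torus d L,
      (k (p.1 - p.2) * ‖w p.1‖ ^ 2 + k (p.1 - p.2) * ‖w p.2‖ ^ 2 -
        k (p.1 - p.2) * ‖w p.1 - w p.2‖ ^ 2) / 2 := by
    rw [show (volume : Measure (Torus d L × Torus d L)) = volume.prod volume from rfl,
      integral_prod (fun p : Torus d L × Torus d L => (k (p.1 - p.2) * ‖w p.1‖ ^ 2 +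
        k (p.1 - p.2) * ‖w p.2‖ ^ 2 - k (p.1 - p.2) * ‖w p.1 - w p.2‖ ^ 2) / 2)
        (((hint1.add hint2).sub hint).div_const 2)]
    refine integral_congr_ae (ae_of_all _ fun x => ?_)
    simp only [torusConv]
    rw [← integral_inner (integrable_kernel_smul hk.smooth hwi x)]
    refine integral_congr_ae (ae_of_all _ fun y => ?_)
    simp only [inner_smul_right, norm_sub_sq_real]
    ring
  have h4 : 2 * ((∫ x, ‖w x‖ ^ 2) - ∫ x, inner ℝ (w x) (torusConv k w x)) =
      ∫ x, ∫ y, k (x - y) * ‖w x - w y‖ ^ 2 := by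
    have hv : (volume : Measure (Torus d L × Torus d L)) = volume.prod volume := rfl
    rw [hv] at h1 h2
    rw [h3, hv, integral_half_add_sub hint1 hint2 hint, h1, h2, integral_prod _ hint]
    ring
  have h5 : 0 ≤ ∫ x, ∫ y, k (x - y) * ‖w x - w y‖ ^ 2 := integral_nonneg fun x =>
    integral_nonneg fun y => mul_nonneg (hk.nonneg _) (sq_nonneg _)
  rw [abs_le]
  constructor <;> linarith

end

section

/-- The `L²` norm of a vector-valued function, as a real number. -/
def l2norm {α E : Type*} [MeasureSpace α] [NormedAddCommGroup E] (f : α → E) : ℝ :=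
  Real.sqrt (∫ x, ‖f x‖ ^ 2)

section

variable {α E : Type*} [MeasureSpace α] [NormedAddCommGroup E]

theorem l2norm_nonneg (f : α → E) : 0 ≤ l2norm f := Real.sqrt_nonneg _

theorem l2norm_sq (f : α → E) : l2norm f ^ 2 = ∫ x, ‖f x‖ ^ 2 :=
  Real.sq_sqrt (integral_nonneg fun _ => sq_nonneg _)

theorem l2norm_le_of_norm_le [IsFiniteMeasure (volume : Measure α)] {f : α → E} {C : ℝ}
    (hC : 0 ≤ C) (h : ∀ x, ‖f x‖ ≤ C) :
    l2norm f ≤ C * Real.sqrt (volume.real (univ : Set α)) := by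
  rw [l2norm, ← Real.sqrt_sq hC, ← Real.sqrt_mul (sq_nonneg _)]
  refine Real.sqrt_le_sqrt ?_
  calc _ ≤ ∫ _ : α, C ^ 2 := integral_mono_of_nonneg (ae_of_all _ fun _ => sq_nonneg _)
        (integrable_const _) (ae_of_all _ fun x => by have := h x; dsimp only; gcongr)
    _ = _ := by rw [integral_const, smul_eq_mul, mul_comm]

variable [InnerProductSpace ℝ E]

theorem norm_toLp_eq_l2norm {f : α → E} (hf : MemLp f 2) : ‖hf.toLp f‖ = l2norm f := by
  rw [l2norm, ← norm_toLp_two_sq hf, Real.sqrt_sq (norm_nonneg _)]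

theorem abs_integral_inner_le {f g : α → E} (hf : MemLp f 2) (hg : MemLp g 2) :
    |∫ x, inner ℝ (f x) (g x)| ≤ l2norm f * l2norm g := by
  have h : ∫ x, inner ℝ (f x) (g x) = inner ℝ (hf.toLp f) (hg.toLp g) := by
    rw [L2.inner_def]
    refine integral_congr_ae ?_
    filter_upwards [hf.coeFn_toLp, hg.coeFn_toLp] with x h1 h2
    rw [h1, h2]
  rw [h, ← norm_toLp_eq_l2norm hf, ← norm_toLp_eq_l2norm hg]
  exact abs_real_inner_le_norm _ _

theorem l2norm_sub_le {f g : α → E} (hf : MemLp f 2) (hg : MemLp g 2) :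
    l2norm (fun x => f x - g x) ≤ l2norm f + l2norm g := by
  have h := norm_sub_le (hf.toLp f) (hg.toLp g)
  rw [← MemLp.toLp_sub] at h
  simp only [norm_toLp_eq_l2norm] at h
  exact h

theorem integrable_inner_of_memLp {f g : α → E} (hf : MemLp f 2) (hg : MemLp g 2) :
    Integrable (fun x => (inner ℝ (f x) (g x) : ℝ)) := by
  refine (hf.norm.integrable_mul hg.norm).mono' (hf.1.inner hg.1)
    (ae_of_all _ fun x => norm_inner_le_norm _ _)

end

theorem integral_norm_le_l2norm {α E : Type*} [MeasureSpace α] [NormedAddCommGroup E]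
    [IsFiniteMeasure (volume : Measure α)] {f : α → E}
    (hf : MemLp f 2) : ∫ x, ‖f x‖ ≤ Real.sqrt (volume.real (univ : Set α)) * l2norm f := by
  have h1 : MemLp (fun _ : α => (1 : ℝ)) 2 := memLp_const 1
  have h := abs_integral_inner_le h1 hf.norm
  have h2 : l2norm (fun x => ‖f x‖) = l2norm f := by simp [l2norm]
  have h3 : l2norm (fun _ : α => (1 : ℝ)) = Real.sqrt (volume.real (univ : Set α)) := by
    simp [l2norm]
  rw [h2, h3] at h
  refine le_trans (le_of_eq_of_le ?_ (le_abs_self _)) h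
  simp

section

variable {d : ℕ} {L : ℝ} [Fact (0 < L)]

theorem TorusSmooth.memLp {F : Type*} [NormedAddCommGroup F] [NormedSpace ℝ F]
    {f : Torus d L → F} (hf : TorusSmooth f) (p : ℝ≥0∞) : MemLp f p :=
  hf.continuous.memLp_of_hasCompactSupport (HasCompactSupport.of_compactSpace _)

theorem exists_l2norm_torusConv_le {E : Type*} [NormedAddCommGroup E] [InnerProductSpace ℝ E]
    {k : Torus d L → ℝ} (hk : TorusSmooth k) :
    ∃ C, 0 ≤ C ∧ ∀ z : Torus d L → E, MemLp z 2 → l2norm (torusConv k z) ≤ C * l2norm z := by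
  obtain ⟨c, hc0, hc⟩ := hk.exists_bound
  set V := volume.real (univ : Set (Torus d L))
  refine ⟨c * Real.sqrt V * Real.sqrt V, by positivity, fun z hz => ?_⟩
  have hI : 0 ≤ ∫ x, ‖z x‖ := integral_nonneg fun _ => norm_nonneg _
  calc _ ≤ c * (∫ x, ‖z x‖) * Real.sqrt V := l2norm_le_of_norm_le (by positivity) fun x =>
        norm_torusConv_le hc (hz.integrable (by norm_num)) x
    _ ≤ c * (Real.sqrt V * l2norm z) * Real.sqrt V := by
        gcongr
        exact integral_norm_le_l2norm hz
    _ = _ := by ring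

theorem sum_torusPartial_torusConv_eq_zero {k : Torus d L → ℝ} (hk : TorusSmooth k)
    {z : Torus d L → EuclideanSpace ℝ (Fin d)} (hz : Integrable z) (hdiv : IsWeaklyDivFree z)
    (x : Torus d L) : ∑ i, torusPartial i (torusConv k z) x i = 0 := by
  have h := hdiv (fun y => k (x - y)) (hk.comp_sub_left x)
  simp only [torusPartial_comp_sub_left, mul_neg, Finset.sum_neg_distrib, integral_neg,
    neg_eq_zero] at h
  have hi : ∀ i j, Integrable (fun y => (torusPartial i k (x - y) • z y) j) := fun i j =>
    (EuclideanSpace.proj (𝕜 := ℝ) j).integrable_comp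
      (integrable_kernel_smul (hk.torusPartial i) hz x)
  have hp : ∀ i, torusPartial i (torusConv k z) x i =
      ∫ y, z y i * torusPartial i k (x - y) := fun i => by
    rw [torusPartial_torusConv hk hz, torusConv]
    have := (EuclideanSpace.proj (𝕜 := ℝ) i).integral_comp_comm
      (integrable_kernel_smul (hk.torusPartial i) hz x)
    simp only [EuclideanSpace.coe_proj, PiLp.smul_apply, smul_eq_mul] at this
    rw [← this]
    simp only [mul_comm]
  simp only [hp]
  rw [← integral_finsetSum, h]
  intro i _
  simpa [mul_comm] using hi i i

theorem isWeaklyDivFree_shift {z : Torus d L → EuclideanSpace ℝ (Fin d)} (hdiv : IsWeaklyDivFree z)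
    (y : Torus d L) : IsWeaklyDivFree (fun x => z (x - y)) := by
  intro ψ hψ
  have h := hdiv (fun x => ψ (x - (-y))) (TorusSmooth.comp_sub_right (f := ψ) hψ (-y))
  simp only [torusPartial_comp_sub_right] at h
  rw [← integral_sub_right_eq_self _ y] at h
  simpa only [sub_neg_eq_add, sub_add_cancel] using h

theorem isWeaklyDivFree_torusConv {k : Torus d L → ℝ} (hk : TorusSmooth k)
    {z : Torus d L → EuclideanSpace ℝ (Fin d)} (hz : Integrable z) (hdiv : IsWeaklyDivFree z) :
    IsWeaklyDivFree (torusConv k z) := by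
  intro ψ hψ
  have hψ' : TorusSmooth ψ := hψ
  have hΦ : MeasurePreserving (fun p : Torus d L × Torus d L => (p.1, p.1 - p.2))
      (volume.prod volume) (volume.prod volume) := by
    have h1 : MeasurePreserving (fun p : Torus d L × Torus d L => (p.1, -p.2))
      (volume.prod volume) (volume.prod volume) :=
      (MeasurePreserving.id _).prod (Measure.measurePreserving_neg volume)
    have h2 := (measurePreserving_prod_add (volume : Measure (Torus d L)) volume).comp h1
    simpa [Function.comp_def, sub_eq_add_neg] using h2
  have hzi : ∀ i, Integrable (fun x => z x i) := fun i =>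
    (EuclideanSpace.proj (𝕜 := ℝ) i).integrable_comp hz
  obtain ⟨c, -, hc⟩ := hk.exists_bound
  choose a ha0 ha using fun i => (hψ'.torusPartial i).exists_bound
  have hzs : ∀ i, Integrable (fun p : Torus d L × Torus d L => z (p.1 - p.2) i)
      (volume.prod volume) := fun i => by
    have := ((hzi i).comp_snd (volume : Measure (Torus d L)))
    exact hΦ.integrable_comp_of_integrable this
  have hint : Integrable (fun p : Torus d L × Torus d L =>
      k p.2 * ∑ i, z (p.1 - p.2) i * torusPartial i ψ p.1) (volume.prod volume) := by
    refine Integrable.bdd_mul ?_ (hk.continuous.comp continuous_snd).aestronglyMeasurable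
      (ae_of_all _ fun p => hc _)
    exact integrable_finsetSum _ fun i _ => (hzs i).mul_bdd
      (((hψ'.torusPartial i).continuous.comp continuous_fst).aestronglyMeasurable)
      (ae_of_all _ fun p => ha i _)
  have hx : ∀ x, ∑ i, torusConv k z x i * torusPartial i ψ x =
      ∫ y, k y * ∑ i, z (x - y) i * torusPartial i ψ x := fun x => by
    have hzx : Integrable (fun y => k y • z (x - y)) := by
      simpa using (integrable_kernel_smul hk hz x).comp_sub_left x
    have h1 : ∀ i, torusConv k z x i = ∫ y, k y * z (x - y) i := fun i => by
      have := (EuclideanSpace.proj (𝕜 := ℝ) i).integral_comp_comm hzx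
      simpa [torusConv_eq_integral_shift] using this.symm
    have h2 : ∀ i, Integrable (fun y => k y * z (x - y) i * torusPartial i ψ x) := fun i => by
      have := (EuclideanSpace.proj (𝕜 := ℝ) i).integrable_comp hzx
      exact Integrable.mul_const (by simpa using this) _
    simp only [h1, ← integral_mul_const, Finset.mul_sum, ← mul_assoc]
    rw [integral_finsetSum _ fun i _ => h2 i]
  simp only [hx]
  rw [integral_integral_swap hint]
  refine integral_eq_zero_of_ae (ae_of_all _ fun y => ?_)
  simp only [integral_const_mul, isWeaklyDivFree_shift hdiv y ψ hψ, mul_zero, Pi.zero_apply]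

theorem IsWeaklyDivFree.sub {z z' : Torus d L → EuclideanSpace ℝ (Fin d)}
    (hz : Integrable z) (hz' : Integrable z') (h : IsWeaklyDivFree z) (h' : IsWeaklyDivFree z') :
    IsWeaklyDivFree (fun x => z x - z' x) := by
  intro ψ hψ
  have hψ' : TorusSmooth ψ := hψ
  choose a ha0 ha using fun i => (hψ'.torusPartial i).exists_bound
  have hi : ∀ {z : Torus d L → EuclideanSpace ℝ (Fin d)}, Integrable z →
      Integrable (fun x => ∑ i, z x i * torusPartial i ψ x) := fun hz =>
    integrable_finsetSum _ fun i _ => ((EuclideanSpace.proj (𝕜 := ℝ) i).integrable_comp hz).mul_bdd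
      (hψ'.torusPartial i).continuous.aestronglyMeasurable (ae_of_all _ fun p => ha i _)
  simp only [PiLp.sub_apply, sub_mul, Finset.sum_sub_distrib]
  rw [integral_sub (hi hz) (hi hz'), h ψ hψ, h' ψ hψ, sub_zero]

theorem IsWeaklyDivFree.add {z z' : Torus d L → EuclideanSpace ℝ (Fin d)}
    (hz : Integrable z) (hz' : Integrable z') (h : IsWeaklyDivFree z) (h' : IsWeaklyDivFree z') :
    IsWeaklyDivFree (fun x => z x + z' x) := by
  have h0 : IsWeaklyDivFree (fun _ : Torus d L => (0 : EuclideanSpace ℝ (Fin d))) := by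
    intro ψ _; simp
  simpa using h.sub hz (by simpa using hz'.neg) (h0.sub (integrable_const 0) hz' h')

theorem IsWeaklyDivFree.congr_ae {z z' : Torus d L → EuclideanSpace ℝ (Fin d)}
    (h : IsWeaklyDivFree z) (hzz : z =ᵐ[volume] z') : IsWeaklyDivFree z' := by
  intro ψ hψ
  rw [← h ψ hψ]
  exact integral_congr_ae (hzz.mono fun x hx => by simp only [hx])

theorem exists_countable_dense_memL2Div (d : ℕ) (L : ℝ) [Fact (0 < L)] :
    ∃ D : ℕ → Torus d L → EuclideanSpace ℝ (Fin d), (∀ n, MemL2Div (D n)) ∧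
      ∀ z, MemL2Div z → ∀ ε > 0, ∃ n, l2norm (fun x => z x - D n x) < ε := by
  have : Fact ((2 : ℝ≥0∞) ≠ ⊤) := ⟨by simp⟩
  let S := {f : Lp (EuclideanSpace ℝ (Fin d)) 2 (volume : Measure (Torus d L)) //
    IsWeaklyDivFree (f : Torus d L → EuclideanSpace ℝ (Fin d))}
  have : Nonempty S := ⟨⟨0, fun ψ hψ => by
    rw [← integral_zero (Torus d L) ℝ]
    refine integral_congr_ae ((Lp.coeFn_zero (EuclideanSpace ℝ (Fin d)) 2 volume).mono fun x hx => ?_)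
    simp⟩⟩
  have : SecondCountableTopology (Lp (EuclideanSpace ℝ (Fin d)) 2
    (volume : Measure (Torus d L))) := inferInstance
  refine ⟨fun n => (TopologicalSpace.denseSeq S n).1,
    fun n => ⟨Lp.memLp _, (TopologicalSpace.denseSeq S n).2⟩, fun z hz ε hε => ?_⟩
  let s : S := ⟨hz.1.toLp z, hz.2.congr_ae hz.1.coeFn_toLp.symm⟩
  obtain ⟨_, hn, ⟨n, rfl⟩⟩ := Metric.dense_iff.1 (TopologicalSpace.denseRange_denseSeq S) s ε hε
  refine ⟨n, ?_⟩
  have h1 : MemLp (fun x => z x - (TopologicalSpace.denseSeq S n).1 x) 2 :=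
    hz.1.sub (Lp.memLp _)
  rw [← norm_toLp_eq_l2norm h1]
  rw [Metric.mem_ball, dist_comm, Subtype.dist_eq, dist_eq_norm] at hn
  refine lt_of_eq_of_lt ?_ hn
  congr 1
  refine (MemLp.toLp_sub hz.1 (Lp.memLp (TopologicalSpace.denseSeq S n).1)).trans ?_
  rw [Lp.toLp_coeFn]

end

end

section

theorem contDiff_integral_of_contDiff {θ : ℝ → ℝ} (hθ : ContDiff ℝ ∞ θ) :
    ContDiff ℝ ∞ (fun t => ∫ s in (0 : ℝ)..t, θ s) := by
  have h : ∀ t, HasDerivAt (fun t => ∫ s in (0 : ℝ)..t, θ s) (θ t) t := fun t =>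
    hθ.continuous.integral_hasStrictDerivAt 0 t |>.hasDerivAt
  refine contDiff_infty_iff_deriv.2 ⟨fun t => (h t).differentiableAt, ?_⟩
  rwa [show deriv (fun t => ∫ s in (0 : ℝ)..t, θ s) = θ from funext fun t => (h t).deriv]

/-- Fubini for `∫ b(t) ∫_t^∞ θ`. -/
theorem integral_mul_integral_Ioi_eq {b θ : ℝ → ℝ} (hb : IntegrableOn b (Ioi 0))
    (hθ : IntegrableOn θ (Ioi 0)) :
    ∫ t in Ioi (0 : ℝ), b t * ∫ s in Ioi t, θ s =
      ∫ s in Ioi (0 : ℝ), θ s * ∫ t in (0 : ℝ)..s, b t := by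
  have hprod : Integrable (fun p : ℝ × ℝ => b p.1 * θ p.2)
      ((volume.restrict (Ioi (0 : ℝ))).prod (volume.restrict (Ioi (0 : ℝ)))) :=
    Integrable.mul_prod hb hθ
  have hind : Integrable (fun p : ℝ × ℝ => {p : ℝ × ℝ | p.1 < p.2}.indicator
      (fun p => b p.1 * θ p.2) p)
      ((volume.restrict (Ioi (0 : ℝ))).prod (volume.restrict (Ioi (0 : ℝ)))) :=
    hprod.indicator (measurableSet_lt measurable_fst measurable_snd)
  calc _ = ∫ t in Ioi (0 : ℝ), ∫ s in Ioi (0 : ℝ),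
        {p : ℝ × ℝ | p.1 < p.2}.indicator (fun p => b p.1 * θ p.2) (t, s) := by
        refine setIntegral_congr_fun measurableSet_Ioi fun t ht => ?_
        have h1 : ∀ s, {p : ℝ × ℝ | p.1 < p.2}.indicator (fun p => b p.1 * θ p.2) (t, s) =
            (Ioi t).indicator (fun s => b t * θ s) s := fun s => by
          simp [indicator]
        simp only [h1]
        rw [setIntegral_indicator measurableSet_Ioi, integral_const_mul,
          inter_eq_right.2 (Ioi_subset_Ioi (le_of_lt ht))]
    _ = ∫ s in Ioi (0 : ℝ), ∫ t in Ioi (0 : ℝ),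
        {p : ℝ × ℝ | p.1 < p.2}.indicator (fun p => b p.1 * θ p.2) (t, s) :=
        integral_integral_swap hind
    _ = _ := by
        refine setIntegral_congr_fun measurableSet_Ioi fun s hs => ?_
        have h1 : ∀ t, {p : ℝ × ℝ | p.1 < p.2}.indicator (fun p => b p.1 * θ p.2) (t, s) =
            (Iio s).indicator (fun t => θ s * b t) t := fun t => by
          simp [indicator, mul_comm]
        simp only [h1]
        rw [setIntegral_indicator measurableSet_Iio, integral_const_mul,
          intervalIntegral.integral_of_le (le_of_lt hs), integral_Ioc_eq_integral_Ioo,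
          Ioi_inter_Iio]

/-- A bounded function whose distributional derivative on `[0, ∞)` is the integrable function `b`,
with initial value `a₀`, is almost everywhere the primitive of `b`. -/
theorem ae_eq_add_integral_of_weak_deriv {a b : ℝ → ℝ} {a₀ C : ℝ}
    (ha : AEStronglyMeasurable a timeMeasure) (haC : ∀ t, ‖a t‖ ≤ C)
    (hb : IntegrableOn b (Ioi 0))
    (h : ∀ η : ℝ → ℝ, ContDiff ℝ ∞ η → HasCompactSupport η →
      (∫ t in Ioi (0 : ℝ), (a t * deriv η t + b t * η t)) + a₀ * η 0 = 0) :
    ∀ᵐ t ∂timeMeasure, a t = a₀ + ∫ s in (0 : ℝ)..t, b s := by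
  have hbi : ∀ t, 0 ≤ t → IntervalIntegrable b volume 0 t := fun t ht =>
    (intervalIntegrable_iff_integrableOn_Ioc_of_le ht).2 (hb.mono_set Ioc_subset_Ioi_self)
  have hB : ContinuousOn (fun t => ∫ s in (0 : ℝ)..t, b s) (Ioi 0) := by
    have h1 : Integrable ((Ioi (0 : ℝ)).indicator b) := hb.integrable_indicator measurableSet_Ioi
    refine (intervalIntegral.continuous_primitive (fun _ _ => h1.intervalIntegrable) 0
      ).continuousOn.congr fun t ht => ?_
    refine intervalIntegral.integral_congr_ae (ae_of_all _ fun s hs => ?_)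
    rw [uIoc_of_le (le_of_lt ht)] at hs
    rw [indicator_of_mem (show s ∈ Ioi (0 : ℝ) from hs.1)]
  have hBb : ∀ t, 0 < t → ‖∫ s in (0 : ℝ)..t, b s‖ ≤ ∫ s in Ioi (0 : ℝ), ‖b s‖ := fun t ht => by
    rw [intervalIntegral.integral_of_le ht.le]
    exact (norm_integral_le_integral_norm _).trans (setIntegral_mono_set hb.norm
      (ae_of_all _ fun _ => norm_nonneg _) Ioc_subset_Ioi_self.eventuallyLE)
  have hBm : AEStronglyMeasurable (fun t => ∫ s in (0 : ℝ)..t, b s) timeMeasure :=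
    hB.aestronglyMeasurable measurableSet_Ioi
  have key : ∀ᵐ t : ℝ, t ∈ Ioi (0 : ℝ) → a t - (a₀ + ∫ s in (0 : ℝ)..t, b s) = 0 := by
    refine isOpen_Ioi.ae_eq_zero_of_integral_contDiff_smul_eq_zero ?_ fun θ hθ hθc hθs => ?_
    · refine locallyIntegrableOn_of_locallyIntegrable_restrict
        (MemLp.locallyIntegrable (p := ⊤) ?_ le_top)
      refine memLp_top_of_bound (C := C + (‖a₀‖ + ∫ s in Ioi (0 : ℝ), ‖b s‖))
        (ha.sub (aestronglyMeasurable_const.add hBm))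
        (ae_restrict_of_forall_mem measurableSet_Ioi fun t ht => ?_)
      exact (norm_sub_le _ _).trans (add_le_add (haC t)
        ((norm_add_le _ _).trans (add_le_add_right (hBb t ht) _)))
    have hθ0 : ∀ t ≤ 0, θ t = 0 := fun t ht => by
      by_contra h0
      exact absurd (hθs (subset_tsupport _ h0)) (not_lt.2 ht)
    have hθi : Integrable θ := hθ.continuous.integrable_of_hasCompactSupport hθc
    set I := ∫ s in Ioi (0 : ℝ), θ s with hI
    set Θ : ℝ → ℝ := fun t => ∫ s in (0 : ℝ)..t, θ s with hΘ
    have hΘd : ∀ t, HasDerivAt Θ (θ t) t := fun t =>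
      (hθ.continuous.integral_hasStrictDerivAt 0 t).hasDerivAt
    obtain ⟨T, hT⟩ : ∃ T, ∀ t, T < t → θ t = 0 := by
      obtain ⟨T, hT⟩ := hθc.isCompact.bddAbove
      exact ⟨T, fun t ht => by
        by_contra h0
        exact absurd (hT (subset_tsupport _ h0)) (not_le.2 ht)⟩
    have htail : ∀ t, 0 ≤ t → Θ t - I = -∫ s in Ioi t, θ s := fun t ht => by
      have h1 := intervalIntegral.integral_interval_add_Ioi (a := 0) (b := t)
        hθi.integrableOn hθi.integrableOn
      simp only [hΘ, hI, ← h1]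
      ring
    set η : ℝ → ℝ := fun t => Real.smoothTransition (t + 2) * (Θ t - I) with hη
    have hηs : ContDiff ℝ ∞ η :=
      (Real.smoothTransition.contDiff.comp (contDiff_id.add contDiff_const)).mul
        ((contDiff_integral_of_contDiff hθ).sub contDiff_const)
    have hηc : HasCompactSupport η := by
      refine HasCompactSupport.intro (isCompact_Icc (a := (-2 : ℝ)) (b := max T 0)) fun t ht => ?_
      rw [mem_Icc, not_and_or, not_le, not_le] at ht
      rcases ht with ht | ht
      · simp [hη, Real.smoothTransition.zero_of_nonpos (by linarith : t + 2 ≤ 0)]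
      · have h0 : ∫ s in Ioi t, θ s = 0 := by
          refine setIntegral_eq_zero_of_forall_eq_zero fun s hs => hT s ?_
          exact (le_max_left T 0).trans_lt (ht.trans hs)
        simp only [hη]
        rw [htail t ((le_max_right T 0).trans ht.le), h0, neg_zero, mul_zero]
    have hη1 : ∀ t, -1 < t → η =ᶠ[nhds t] fun t => Θ t - I := fun t ht =>
      Filter.Eventually.mono (Ioi_mem_nhds ht) fun s (hs : -1 < s) => by
        simp only [hη, Real.smoothTransition.one_of_one_le (by linarith : 1 ≤ s + 2),
          one_mul]
    have hηd : ∀ t, 0 < t → deriv η t = θ t := fun t ht => by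
      rw [(hη1 t (by linarith)).deriv_eq]
      exact ((hΘd t).sub_const I).deriv
    have hη0 : η 0 = -I := by
      rw [(hη1 0 (by norm_num)).eq_of_nhds]
      simp [hΘ]
    have h1 := h η hηs hηc
    have hi1 : Integrable (fun t => a t * θ t) timeMeasure :=
      hθi.restrict.bdd_mul ha (ae_of_all _ haC)
    have hi2 : Integrable (fun t => b t * (Θ t - I)) timeMeasure := by
      have hΘc : Continuous Θ := (contDiff_integral_of_contDiff hθ).continuous
      refine Integrable.mul_bdd (c := ∫ s, ‖θ s‖) hb
        (hΘc.sub continuous_const).aestronglyMeasurable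
        (ae_restrict_of_forall_mem measurableSet_Ioi fun t ht => ?_)
      rw [htail t (le_of_lt ht), norm_neg]
      exact (norm_integral_le_integral_norm _).trans (setIntegral_le_integral hθi.norm
        (ae_of_all _ fun _ => norm_nonneg _))
    have hi3 : Integrable (fun t => (∫ s in (0 : ℝ)..t, b s) * θ t) timeMeasure :=
      hθi.restrict.bdd_mul hBm (ae_restrict_of_forall_mem measurableSet_Ioi fun t ht => hBb t ht)
    have h2 : ∫ t in Ioi (0 : ℝ), (a t * deriv η t + b t * η t) =
        (∫ t in Ioi (0 : ℝ), a t * θ t) + ∫ t in Ioi (0 : ℝ), b t * (Θ t - I) := by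
      rw [← integral_add hi1 hi2]
      refine setIntegral_congr_fun measurableSet_Ioi fun t ht => ?_
      have ht' : 0 < t := ht
      simp only [hηd t ht', (hη1 t (by linarith)).eq_of_nhds]
    have h3 : ∫ t in Ioi (0 : ℝ), b t * (Θ t - I) =
        -∫ t in Ioi (0 : ℝ), (∫ s in (0 : ℝ)..t, b s) * θ t := by
      have h4 := integral_mul_integral_Ioi_eq hb hθi.integrableOn
      simp only [mul_comm (θ _)] at h4
      rw [← h4, ← integral_neg]
      refine setIntegral_congr_fun measurableSet_Ioi fun t ht => ?_
      simp only [htail t (le_of_lt ht), mul_neg]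
    rw [h2, h3, hη0] at h1
    rw [← setIntegral_eq_integral_of_forall_compl_eq_zero (s := Ioi 0) fun t ht => by
      rw [hθ0 t (not_lt.1 ht), zero_smul]]
    have h5 : ∀ t, θ t • (a t - (a₀ + ∫ s in (0 : ℝ)..t, b s)) =
        (a t * θ t - a₀ * θ t) - (∫ s in (0 : ℝ)..t, b s) * θ t := fun t => by
      rw [smul_eq_mul]; ring
    simp only [h5]
    rw [integral_sub (f := fun t => a t * θ t - a₀ * θ t) (hi1.sub (hθi.restrict.const_mul a₀)) hi3,
      integral_sub hi1 (hθi.restrict.const_mul a₀), integral_const_mul]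
    linarith
  rw [ae_restrict_iff' measurableSet_Ioi]
  filter_upwards [key] with t ht h0
  linarith [ht h0]

/-- If `F` varies on a dense set by at most the increment of `N` up to a superlinear error in the
increment of a continuous function `M`, then it varies at most like `N`. -/
theorem abs_sub_le_of_superlinear {A : Set ℝ} {F N M : ℝ → ℝ} {C : ℝ} (hC : 0 ≤ C)
    (hA : ∀ a b, 0 ≤ a → a < b → ∃ c ∈ A, a < c ∧ c < b) (hM : Continuous M) (hMm : Monotone M)
    (h : ∀ s ∈ A, ∀ t ∈ A, s ≤ t → |F t - F s| ≤ N t - N s + C * (M t - M s) ^ 2)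
    {s t : ℝ} (hs0 : 0 ≤ s) (hs : s ∈ A) (ht : t ∈ A) (hst : s ≤ t) :
    |F t - F s| ≤ N t - N s := by
  have key : ∀ ε > 0, |F t - F s| ≤ N t - N s + C * ε * (M t - M s) := by
    intro ε hε
    obtain ⟨δ, hδ, hu⟩ := Metric.uniformContinuousOn_iff.1
      (isCompact_Icc.uniformContinuousOn_of_continuous (hM.continuousOn (s := Icc s t))) ε hε
    have step : ∀ n : ℕ, ∀ a ∈ A, ∀ b ∈ A, s ≤ a → b ≤ t → a ≤ b → b - a ≤ n * (δ / 3) →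
        |F b - F a| ≤ N b - N a + C * ε * (M b - M a) := by
      intro n
      induction n with
      | zero =>
        intro a ha b hb _ _ hab hn
        obtain rfl : a = b := le_antisymm hab (by simpa using hn)
        simp
      | succ n ih =>
        intro a ha b hb hsa hbt hab hn
        have hsmall : ∀ c ∈ A, a ≤ c → c ≤ b → c - a < δ →
            |F c - F a| ≤ N c - N a + C * ε * (M c - M a) := by
          intro c hc hac hcb hd
          have h1 := hu c ⟨hsa.trans hac, hcb.trans hbt⟩ a ⟨hsa, hab.trans hbt⟩ (by
            rw [Real.dist_eq, abs_of_nonneg (by linarith)]; exact hd)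
          have h0 : 0 ≤ M c - M a := sub_nonneg.2 (hMm hac)
          rw [Real.dist_eq, abs_of_nonneg h0] at h1
          refine (h a ha c hc hac).trans (add_le_add_right ?_ _)
          rw [mul_assoc, sq]
          gcongr
        by_cases hd : b - a < δ
        · exact hsmall b hb hab le_rfl hd
        · obtain ⟨c, hc, hac, hcb⟩ := hA (a + δ / 3) (a + 2 * (δ / 3)) (by linarith) (by linarith)
          have h1 := hsmall c hc (by linarith) (by linarith) (by linarith)
          have h2 := ih c hc b hb (by linarith) hbt (by linarith) (by push_cast at hn; linarith)
          have h3 := abs_sub_le (F b) (F c) (F a)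
          nlinarith
    obtain ⟨n, hn⟩ := exists_nat_ge ((t - s) / (δ / 3))
    rw [div_le_iff₀ (by positivity)] at hn
    exact step n s hs t ht le_rfl le_rfl hst hn
  refine le_of_forall_pos_le_add fun ε hε => ?_
  have hD : 0 ≤ M t - M s := sub_nonneg.2 (hMm hst)
  refine (key (ε / (C * (M t - M s) + 1)) (by positivity)).trans (add_le_add_right ?_ _)
  rw [mul_right_comm, mul_div_assoc', div_le_iff₀ (by positivity)]
  nlinarith [mul_nonneg hC hD]

end

section

variable {d : ℕ} {L : ℝ} [Fact (0 < L)]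

/-- The transport term `∫ w · (U · ∇)(k * z)`. -/
def transportForm (U w : Torus d L → EuclideanSpace ℝ (Fin d)) (k : Torus d L → ℝ)
    (z : Torus d L → EuclideanSpace ℝ (Fin d)) : ℝ :=
  ∫ x, inner ℝ (w x) (∑ i, U x i • torusConv (torusPartial i k) z x)

theorem integral_norm_mul_norm_le {α E : Type*} [MeasureSpace α] [NormedAddCommGroup E]
    {f g : α → E} (hf : MemLp f 2) (hg : MemLp g 2) :
    ∫ x, ‖f x‖ * ‖g x‖ ≤ l2norm f * l2norm g := by
  have h := abs_integral_inner_le hg.norm hf.norm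
  have h2 : ∀ f : α → E, l2norm (fun x => ‖f x‖) = l2norm f := fun f => by simp [l2norm]
  rw [h2, h2, mul_comm] at h
  refine le_trans (le_of_eq_of_le ?_ (le_abs_self _)) h
  simp

section transportForm

variable {U w z z' : Torus d L → EuclideanSpace ℝ (Fin d)} {k : Torus d L → ℝ} {m : ℝ}

theorem integrable_transport_summand (hU : Measurable U) (hUm : ∀ x, ‖U x‖ ≤ m)
    (hw : MemLp w 2) {f : Torus d L → EuclideanSpace ℝ (Fin d)} (hf : MemLp f 2) (i : Fin d) :
    Integrable (fun x => inner ℝ (w x) (U x i • f x)) := by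
  simp only [inner_smul_right]
  have hUi : Measurable fun x => U x i := by fun_prop
  exact (integrable_inner_of_memLp hw hf).bdd_mul hUi.aestronglyMeasurable
    (ae_of_all _ fun x => (PiLp.norm_apply_le (U x) i).trans (hUm x))

theorem abs_integral_inner_sum_le (hU : Measurable U) (hUm : ∀ x, ‖U x‖ ≤ m) (hw : MemLp w 2)
    {f : Fin d → Torus d L → EuclideanSpace ℝ (Fin d)} (hf : ∀ i, MemLp (f i) 2) :
    |∫ x, inner ℝ (w x) (∑ i, U x i • f i x)| ≤ m * l2norm w * ∑ i, l2norm (f i) := by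
  have hm0 : 0 ≤ m := (norm_nonneg _).trans (hUm 0)
  simp only [inner_sum]
  rw [integral_finsetSum _ fun i _ => integrable_transport_summand hU hUm hw (hf i) i,
    Finset.mul_sum]
  refine (Finset.abs_sum_le_sum_abs _ _).trans (Finset.sum_le_sum fun i _ => ?_)
  rw [mul_assoc]
  refine le_trans ?_ (mul_le_mul_of_nonneg_left (integral_norm_mul_norm_le hw (hf i)) hm0)
  rw [← integral_const_mul, ← Real.norm_eq_abs]
  refine norm_integral_le_of_norm_le ((hw.norm.integrable_mul (hf i).norm).const_mul m)
    (ae_of_all _ fun x => ?_)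
  rw [inner_smul_right, norm_mul]
  exact mul_le_mul ((PiLp.norm_apply_le (U x) i).trans (hUm x)) (norm_inner_le_norm _ _)
    (norm_nonneg _) hm0

theorem TorusSmooth.memLp_conv (hk : TorusSmooth k) (hz : MemLp z 2) : MemLp (torusConv k z) 2 :=
  (hk.conv (hz.integrable (by norm_num))).memLp 2

theorem abs_transportForm_le (hU : Measurable U) (hUm : ∀ x, ‖U x‖ ≤ m) (hw : MemLp w 2)
    (hk : TorusSmooth k) (hz : MemLp z 2) :
    |transportForm U w k z| ≤ m * l2norm w * ∑ i, l2norm (torusConv (torusPartial i k) z) :=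
  abs_integral_inner_sum_le hU hUm hw fun i => (hk.torusPartial i).memLp_conv hz

theorem integrable_transport (hU : Measurable U) (hUm : ∀ x, ‖U x‖ ≤ m) (hw : MemLp w 2)
    (hk : TorusSmooth k) (hz : MemLp z 2) :
    Integrable fun x => (inner ℝ (w x) (∑ i, U x i • torusConv (torusPartial i k) z x) : ℝ) := by
  simp only [inner_sum]
  exact integrable_finsetSum _ fun i _ =>
    integrable_transport_summand hU hUm hw ((hk.torusPartial i).memLp_conv hz) i

theorem transportForm_sub (hU : Measurable U) (hUm : ∀ x, ‖U x‖ ≤ m) (hw : MemLp w 2)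
    (hk : TorusSmooth k) (hz : MemLp z 2) (hz' : MemLp z' 2) :
    transportForm U w k (fun x => z x - z' x) = transportForm U w k z - transportForm U w k z' := by
  simp only [transportForm]
  rw [← integral_sub (integrable_transport hU hUm hw hk hz) (integrable_transport hU hUm hw hk hz')]
  congr 1; ext x
  rw [← inner_sub_right, ← Finset.sum_sub_distrib]
  congr 1
  refine Finset.sum_congr rfl fun i _ => ?_
  rw [torusConv_sub (hk.torusPartial i) (hz.integrable (by norm_num))
    (hz'.integrable (by norm_num)), smul_sub]

theorem transportForm_add (hU : Measurable U) (hUm : ∀ x, ‖U x‖ ≤ m) (hw : MemLp w 2)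
    (hk : TorusSmooth k) (hz : MemLp z 2) (hz' : MemLp z' 2) :
    transportForm U w k (fun x => z x + z' x) = transportForm U w k z + transportForm U w k z' := by
  simp only [transportForm]
  rw [← integral_add (integrable_transport hU hUm hw hk hz) (integrable_transport hU hUm hw hk hz')]
  congr 1; ext x
  rw [← inner_add_right, ← Finset.sum_add_distrib]
  congr 1
  refine Finset.sum_congr rfl fun i _ => ?_
  rw [torusConv_add (hk.torusPartial i) (hz.integrable (by norm_num))
    (hz'.integrable (by norm_num)), smul_add]

end transportForm

theorem stronglyMeasurable_torusConv {w : ℝ → Torus d L → EuclideanSpace ℝ (Fin d)}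
    (hw : Measurable fun p : ℝ × Torus d L => w p.1 p.2) {k : Torus d L → ℝ} (hk : Continuous k) :
    Measurable fun p : ℝ × Torus d L => torusConv k (w p.1) p.2 := by
  have h : StronglyMeasurable fun q : (ℝ × Torus d L) × Torus d L =>
      k (q.1.2 - q.2) • w q.1.1 q.2 := by
    have h1 : Measurable fun q : (ℝ × Torus d L) × Torus d L => k (q.1.2 - q.2) :=
      (hk.comp ((continuous_snd.comp continuous_fst).sub continuous_snd)).measurable
    have h2 : Measurable fun q : (ℝ × Torus d L) × Torus d L => w q.1.1 q.2 :=
      hw.comp ((measurable_fst.comp measurable_fst).prodMk measurable_snd)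
    exact (h1.smul h2).stronglyMeasurable
  exact h.integral_prod_right'.measurable

theorem measurable_transportForm {U w z : ℝ → Torus d L → EuclideanSpace ℝ (Fin d)}
    (hU : Measurable fun p : ℝ × Torus d L => U p.1 p.2)
    (hw : Measurable fun p : ℝ × Torus d L => w p.1 p.2)
    (hz : Measurable fun p : ℝ × Torus d L => z p.1 p.2)
    {k : Torus d L → ℝ} (hk : TorusSmooth k) :
    Measurable fun t => transportForm (U t) (w t) k (z t) := by
  have hUi : ∀ i, Measurable fun p : ℝ × Torus d L => U p.1 p.2 i := fun i => by fun_prop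
  have h : StronglyMeasurable fun p : ℝ × Torus d L => (inner ℝ (w p.1 p.2)
      (∑ i, U p.1 p.2 i • torusConv (torusPartial i k) (z p.1) p.2) : ℝ) := by
    refine Measurable.stronglyMeasurable (hw.inner (Finset.measurable_fun_sum _ fun i _ =>
      (hUi i).smul (stronglyMeasurable_torusConv hz (hk.torusPartial i).continuous)))
  exact h.integral_prod_right'.measurable

theorem measurable_integral_inner {w : ℝ → Torus d L → EuclideanSpace ℝ (Fin d)}
    (hw : Measurable fun p : ℝ × Torus d L => w p.1 p.2)
    {ψ : Torus d L → EuclideanSpace ℝ (Fin d)} (hψ : Continuous ψ) :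
    Measurable fun t => ∫ x, (inner ℝ (w t x) (ψ x) : ℝ) := by
  have h : StronglyMeasurable fun p : ℝ × Torus d L => (inner ℝ (w p.1 p.2) (ψ p.2) : ℝ) :=
    Measurable.stronglyMeasurable (hw.inner (hψ.measurable.comp measurable_snd))
  exact h.integral_prod_right'.measurable

theorem isTestField_smul {η : ℝ → ℝ} (hη : ContDiff ℝ ∞ η) (hηc : HasCompactSupport η)
    {ψ : Torus d L → EuclideanSpace ℝ (Fin d)} (hψ : TorusSmooth ψ)
    (hdiv : ∀ x, ∑ i, torusPartial i ψ x i = 0) : IsTestField (fun t x => η t • ψ x) where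
  smooth := (hη.comp contDiff_fst).smul
    (ContDiff.comp (g := fun y => ψ (toTorus d L y)) hψ contDiff_snd)
  compactSupport := by
    refine HasCompactSupport.intro (K := tsupport η ×ˢ univ)
      (hηc.isCompact.prod isCompact_univ) fun p hp => ?_
    have : p.1 ∉ tsupport η := fun h => hp ⟨h, trivial⟩
    simp only [image_eq_zero_of_notMem_tsupport this, zero_smul]
  divFree t x := by
    have h : ∀ i, torusPartial i (fun x => η t • ψ x) x = η t • torusPartial i ψ x := fun i => by
      simp only [torusPartial]
      exact deriv_fun_const_smul_field _ _
    simp only [h, PiLp.smul_apply, smul_eq_mul, ← Finset.mul_sum, hdiv, mul_zero]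

/-- A weak solution of the transport-projection equation normalised so that all bounds hold for
every time and the solution is extended by its initial value. -/
structure TransportData (U w : ℝ → Torus d L → EuclideanSpace ℝ (Fin d))
    (w₀ : Torus d L → EuclideanSpace ℝ (Fin d)) (m ℓ : ℝ → ℝ) (B : ℝ) : Prop where
  measurable_U : Measurable (fun p : ℝ × Torus d L => U p.1 p.2)
  measurable_w : Measurable (fun p : ℝ × Torus d L => w p.1 p.2)
  norm_U_le : ∀ t x, ‖U t x‖ ≤ m t
  integrable_m : Integrable m
  integrable_ℓ : Integrable ℓ
  ℓ_nonneg : ∀ t, 0 ≤ ℓ t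
  lipschitz_U : ∀ t, ∃ s : Set (Torus d L), (∀ᵐ x, x ∈ s) ∧
    ∀ x ∈ s, ∀ y ∈ s, ‖U t x - U t y‖ ≤ ℓ t * ‖x - y‖
  divFree_U : ∀ t, IsWeaklyDivFree (U t)
  memL2Div_w : ∀ t, MemL2Div (w t)
  l2norm_w_le : ∀ t, l2norm (w t) ≤ B
  w_of_nonpos : ∀ t ≤ 0, w t = w₀
  weakForm : ∀ φ : ℝ → Torus d L → EuclideanSpace ℝ (Fin d), IsTestField φ →
    (∫ t in Ioi (0 : ℝ), ∫ x,
        (inner ℝ (w t x) (deriv (fun s => φ s x) t)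
          + inner ℝ (∑ i, U t x i • torusPartial i (φ t) x) (w t x)))
      + ∫ x, inner ℝ (w₀ x) (φ 0 x) = 0

namespace TransportData

variable {U w : ℝ → Torus d L → EuclideanSpace ℝ (Fin d)}
  {w₀ : Torus d L → EuclideanSpace ℝ (Fin d)} {m ℓ : ℝ → ℝ} {B : ℝ}

theorem measurable_U_apply (h : TransportData U w w₀ m ℓ B) (t : ℝ) : Measurable (U t) :=
  h.measurable_U.comp measurable_prodMk_left

theorem m_nonneg (h : TransportData U w w₀ m ℓ B) (t : ℝ) : 0 ≤ m t :=
  (norm_nonneg _).trans (h.norm_U_le t 0)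

theorem B_nonneg (h : TransportData U w w₀ m ℓ B) : 0 ≤ B :=
  (l2norm_nonneg _).trans (h.l2norm_w_le 0)

theorem memLp_w (h : TransportData U w w₀ m ℓ B) (t : ℝ) : MemLp (w t) 2 := (h.memL2Div_w t).1

theorem integrable_w (h : TransportData U w w₀ m ℓ B) (t : ℝ) : Integrable (w t) :=
  (h.memLp_w t).integrable (by norm_num)

theorem w_zero (h : TransportData U w w₀ m ℓ B) : w 0 = w₀ := h.w_of_nonpos 0 le_rfl

theorem abs_transportForm_le (h : TransportData U w w₀ m ℓ B) {k : Torus d L → ℝ}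
    (hk : TorusSmooth k) {z : Torus d L → EuclideanSpace ℝ (Fin d)} (hz : MemLp z 2) (t : ℝ) :
    |transportForm (U t) (w t) k z| ≤
      m t * (B * ∑ i, l2norm (torusConv (torusPartial i k) z)) := by
  refine (_root_.abs_transportForm_le (h.measurable_U_apply t) (h.norm_U_le t) (h.memLp_w t) hk
    hz).trans ?_
  rw [mul_assoc]
  exact mul_le_mul_of_nonneg_left (mul_le_mul_of_nonneg_right (h.l2norm_w_le t)
    (Finset.sum_nonneg fun i _ => l2norm_nonneg _)) (h.m_nonneg t)

theorem integrable_transportForm (h : TransportData U w w₀ m ℓ B) {k : Torus d L → ℝ}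
    (hk : TorusSmooth k) {z : Torus d L → EuclideanSpace ℝ (Fin d)} (hz : MemLp z 2) :
    Integrable fun t => transportForm (U t) (w t) k z := by
  refine (h.integrable_m.mul_const _).mono' ?_
    (ae_of_all _ fun t => h.abs_transportForm_le hk hz t)
  have h1 : ∀ t, transportForm (U t) (w t) k z = transportForm (U t) (w t) k (hz.1.mk z) :=
    fun t => by simp only [transportForm, torusConv_congr_ae _ hz.1.ae_eq_mk]
  simp only [h1]
  exact (measurable_transportForm h.measurable_U h.measurable_w (z := fun _ => hz.1.mk z)
    (hz.1.stronglyMeasurable_mk.measurable.comp measurable_snd) hk).aestronglyMeasurable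

/-- The weak formulation tested with `k * z`, integrated in time. -/
theorem ae_integral_inner_torusConv_eq (h : TransportData U w w₀ m ℓ B) {k : Torus d L → ℝ}
    (hk : TorusSmooth k) {z : Torus d L → EuclideanSpace ℝ (Fin d)} (hz : MemL2Div z) :
    ∀ᵐ t ∂timeMeasure, ∫ x, inner ℝ (w t x) (torusConv k z x) =
      (∫ x, inner ℝ (w₀ x) (torusConv k z x)) +
        ∫ τ in (0 : ℝ)..t, transportForm (U τ) (w τ) k z := by
  have hzi : Integrable z := hz.1.integrable (by norm_num)
  have hψ := hk.conv hzi
  have hψm := hk.memLp_conv hz.1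
  refine ae_eq_add_integral_of_weak_deriv (C := B * l2norm (torusConv k z))
    (measurable_integral_inner h.measurable_w hψ.continuous).aestronglyMeasurable
    (fun t => (abs_integral_inner_le (h.memLp_w t) hψm).trans
      (mul_le_mul_of_nonneg_right (h.l2norm_w_le t) (l2norm_nonneg _)))
    (h.integrable_transportForm hk hz.1).integrableOn fun η hη hηc => ?_
  have h1 := h.weakForm _ (isTestField_smul hη hηc hψ
    (sum_torusPartial_torusConv_eq_zero hk hzi hz.2))
  refine Eq.trans ?_ h1
  congr 1
  · refine integral_congr_ae (ae_of_all _ fun t => ?_)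
    have hd : ∀ x, deriv (fun s => η s • torusConv k z x) t = deriv η t • torusConv k z x :=
      fun x => deriv_smul_const (hη.differentiable (by simp) t) _
    have hp : ∀ i x, torusPartial i (fun x => η t • torusConv k z x) x =
        η t • torusConv (torusPartial i k) z x := fun i x => by
      rw [← torusPartial_torusConv hk hzi]
      simp only [torusPartial]
      exact deriv_fun_const_smul_field _ _
    simp only [hd, hp]
    have e : ∀ x, inner ℝ (w t x) (deriv η t • torusConv k z x) +
        inner ℝ (∑ i, U t x i • η t • torusConv (torusPartial i k) z x) (w t x) =
        inner ℝ (w t x) (torusConv k z x) * deriv η t +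
        inner ℝ (w t x) (∑ i, U t x i • torusConv (torusPartial i k) z x) * η t := fun x => by
      rw [inner_smul_right, Finset.sum_congr rfl fun i _ => smul_comm _ _ _,
        ← Finset.smul_sum, real_inner_smul_left, real_inner_comm (w t x)]
      ring
    simp only [e]
    rw [integral_add ((integrable_inner_of_memLp (h.memLp_w t) hψm).mul_const _)
      ((integrable_transport (h.measurable_U_apply t) (h.norm_U_le t) (h.memLp_w t) hk
        hz.1).mul_const _), integral_mul_const, integral_mul_const]
    rfl
  · simp only [inner_smul_right]
    rw [integral_const_mul, mul_comm]

end TransportData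

end

section

variable {d : ℕ} {L : ℝ} [Fact (0 < L)]

namespace TransportData

variable {U w : ℝ → Torus d L → EuclideanSpace ℝ (Fin d)}
  {w₀ : Torus d L → EuclideanSpace ℝ (Fin d)} {m ℓ : ℝ → ℝ} {B : ℝ}

theorem exists_sum_l2norm_le {k : Torus d L → ℝ} (hk : TorusSmooth k) :
    ∃ C, 0 ≤ C ∧ ∀ z : Torus d L → EuclideanSpace ℝ (Fin d), MemLp z 2 →
      ∑ i, l2norm (torusConv (torusPartial i k) z) ≤ C * l2norm z := by
  choose C hC0 hC using fun i => exists_l2norm_torusConv_le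
    (E := EuclideanSpace ℝ (Fin d)) (hk.torusPartial i)
  exact ⟨∑ i, C i, Finset.sum_nonneg fun i _ => hC0 i, fun z hz => by
    rw [Finset.sum_mul]; exact Finset.sum_le_sum fun i _ => hC i z hz⟩

theorem abs_integral_transportForm_le (h : TransportData U w w₀ m ℓ B) {k : Torus d L → ℝ}
    (hk : TorusSmooth k) {z : Torus d L → EuclideanSpace ℝ (Fin d)} (hz : MemLp z 2) {s t : ℝ}
    (hst : s ≤ t) :
    |∫ τ in s..t, transportForm (U τ) (w τ) k z| ≤
      (∫ τ in s..t, m τ) * (B * ∑ i, l2norm (torusConv (torusPartial i k) z)) := by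
  rw [← intervalIntegral.integral_mul_const, ← Real.norm_eq_abs]
  exact intervalIntegral.norm_integral_le_of_norm_le hst
    (ae_of_all _ fun τ _ => h.abs_transportForm_le hk hz τ)
    (h.integrable_m.mul_const _).intervalIntegrable

/-- The set of times at which the integrated equation tested with `k * z` holds for all `z`. -/
def goodTimes (U w : ℝ → Torus d L → EuclideanSpace ℝ (Fin d))
    (w₀ : Torus d L → EuclideanSpace ℝ (Fin d)) (k : Torus d L → ℝ) : Set ℝ :=
  {t | ∀ z, MemL2Div z → ∫ x, inner ℝ (w t x) (torusConv k z x) =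
    (∫ x, inner ℝ (w₀ x) (torusConv k z x)) + ∫ τ in (0 : ℝ)..t, transportForm (U τ) (w τ) k z}

theorem zero_mem_goodTimes (h : TransportData U w w₀ m ℓ B) (k : Torus d L → ℝ) :
    0 ∈ goodTimes U w w₀ k := fun z _ => by
  rw [h.w_zero, intervalIntegral.integral_same, add_zero]

theorem ae_mem_goodTimes (h : TransportData U w w₀ m ℓ B) {k : Torus d L → ℝ}
    (hk : TorusSmooth k) : ∀ᵐ t ∂timeMeasure, t ∈ goodTimes U w w₀ k := by
  obtain ⟨D, hD, hDd⟩ := exists_countable_dense_memL2Div d L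
  obtain ⟨C, hC0, hC⟩ := exists_l2norm_torusConv_le (E := EuclideanSpace ℝ (Fin d)) hk
  obtain ⟨C', hC'0, hC'⟩ := exists_sum_l2norm_le hk
  filter_upwards [ae_all_iff.2 fun n => h.ae_integral_inner_torusConv_eq hk (hD n),
    ae_restrict_mem measurableSet_Ioi] with t ht ht0 z hz
  have ht0' : (0 : ℝ) ≤ t := le_of_lt ht0
  set K := B * C + B * C + (∫ τ in (0 : ℝ)..t, m τ) * (B * C')
  have hM0 : 0 ≤ ∫ τ in (0 : ℝ)..t, m τ :=
    intervalIntegral.integral_nonneg ht0' fun τ _ => h.m_nonneg τ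
  have hB0 := h.B_nonneg
  have hK0 : 0 ≤ K := by positivity
  have hw0 : MemLp w₀ 2 := h.w_zero ▸ h.memLp_w 0
  have hw0B : l2norm w₀ ≤ B := h.w_zero ▸ h.l2norm_w_le 0
  rw [← sub_eq_zero, ← abs_nonpos_iff]
  refine le_of_forall_pos_le_add fun ε hε => ?_
  obtain ⟨n, hn⟩ := hDd z hz (ε / (K + 1)) (by positivity)
  set y := fun x => z x - D n x with hy
  have hyL : MemLp y 2 := hz.1.sub (hD n).1
  have hyc := hk.memLp_conv hyL
  have hzi : Integrable z := hz.1.integrable (by norm_num)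
  have hDi : Integrable (D n) := (hD n).1.integrable (by norm_num)
  have e1 : ∀ {f : Torus d L → EuclideanSpace ℝ (Fin d)}, MemLp f 2 →
      ∫ x, inner ℝ (f x) (torusConv k y x) =
        (∫ x, inner ℝ (f x) (torusConv k z x)) - ∫ x, inner ℝ (f x) (torusConv k (D n) x) := by
    intro f hf
    rw [← integral_sub (integrable_inner_of_memLp hf (hk.memLp_conv hz.1))
      (integrable_inner_of_memLp hf (hk.memLp_conv (hD n).1))]
    congr 1; ext x
    rw [hy, torusConv_sub hk hzi hDi, inner_sub_right]
  have e2 : ∫ τ in (0 : ℝ)..t, transportForm (U τ) (w τ) k y =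
      (∫ τ in (0 : ℝ)..t, transportForm (U τ) (w τ) k z) -
        ∫ τ in (0 : ℝ)..t, transportForm (U τ) (w τ) k (D n) := by
    rw [← intervalIntegral.integral_sub (h.integrable_transportForm hk hz.1).intervalIntegrable
      (h.integrable_transportForm hk (hD n).1).intervalIntegrable]
    refine intervalIntegral.integral_congr fun τ _ => ?_
    exact transportForm_sub (h.measurable_U_apply τ) (h.norm_U_le τ) (h.memLp_w τ) hk hz.1 (hD n).1
  have e3 : (∫ x, inner ℝ (w t x) (torusConv k z x)) - ((∫ x, inner ℝ (w₀ x) (torusConv k z x)) +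
      ∫ τ in (0 : ℝ)..t, transportForm (U τ) (w τ) k z) =
      (∫ x, inner ℝ (w t x) (torusConv k y x)) - (∫ x, inner ℝ (w₀ x) (torusConv k y x)) -
      ∫ τ in (0 : ℝ)..t, transportForm (U τ) (w τ) k y := by
    rw [e1 (h.memLp_w t), e1 hw0, e2]
    linarith [ht n]
  have b1 : |∫ x, inner ℝ (w t x) (torusConv k y x)| ≤ B * C * l2norm y := by
    rw [mul_assoc]
    exact (abs_integral_inner_le (h.memLp_w t) hyc).trans (mul_le_mul (h.l2norm_w_le t) (hC y hyL)
      (l2norm_nonneg _) hB0)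
  have b2 : |∫ x, inner ℝ (w₀ x) (torusConv k y x)| ≤ B * C * l2norm y := by
    rw [mul_assoc]
    exact (abs_integral_inner_le hw0 hyc).trans (mul_le_mul hw0B (hC y hyL)
      (l2norm_nonneg _) hB0)
  have b3 : |∫ τ in (0 : ℝ)..t, transportForm (U τ) (w τ) k y| ≤
      (∫ τ in (0 : ℝ)..t, m τ) * (B * C') * l2norm y := by
    refine (h.abs_integral_transportForm_le hk hyL ht0').trans ?_
    rw [mul_assoc, mul_assoc B]
    exact mul_le_mul_of_nonneg_left (mul_le_mul_of_nonneg_left (hC' y hyL) hB0) hM0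
  rw [e3, zero_add]
  calc _ ≤ K * l2norm y := by
        refine (abs_sub _ _).trans ?_
        have := abs_sub (∫ x, inner ℝ (w t x) (torusConv k y x)) (∫ x, inner ℝ (w₀ x) (torusConv k y x))
        simp only [K, add_mul]
        linarith
    _ ≤ (K + 1) * (ε / (K + 1)) := mul_le_mul (by linarith) hn.le (l2norm_nonneg _) (by positivity)
    _ = ε := by field_simp

theorem memL2Div_sub (h : TransportData U w w₀ m ℓ B) (s t : ℝ) :
    MemL2Div (fun x => w t x - w s x) :=
  ⟨(h.memLp_w t).sub (h.memLp_w s), (h.memL2Div_w t).2.sub (h.integrable_w t) (h.integrable_w s)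
    (h.memL2Div_w s).2⟩

theorem integral_inner_sub_eq (h : TransportData U w w₀ m ℓ B) {k : Torus d L → ℝ}
    (hk : TorusSmooth k) {s t : ℝ} (hs : s ∈ goodTimes U w w₀ k) (ht : t ∈ goodTimes U w w₀ k)
    {z : Torus d L → EuclideanSpace ℝ (Fin d)} (hz : MemL2Div z) :
    ∫ x, inner ℝ (w t x - w s x) (torusConv k z x) =
      ∫ τ in s..t, transportForm (U τ) (w τ) k z := by
  have hc := hk.memLp_conv hz.1
  have hi := h.integrable_transportForm hk hz.1
  simp only [inner_sub_left]
  rw [integral_sub (integrable_inner_of_memLp (h.memLp_w t) hc)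
    (integrable_inner_of_memLp (h.memLp_w s) hc), ht z hz, hs z hz,
    ← intervalIntegral.integral_add_adjacent_intervals (hi.intervalIntegrable (a := 0) (b := s))
      (hi.intervalIntegrable (a := s) (b := t))]
  ring

theorem exists_l2norm_partial_conv_sub_le (h : TransportData U w w₀ m ℓ B) {k : Torus d L → ℝ}
    (hk : TorusSmooth k) (hkeven : ∀ x, k (-x) = k x) (i : Fin d) :
    ∃ C, 0 ≤ C ∧ ∀ s ∈ goodTimes U w w₀ (torusPartial i k),
      ∀ t ∈ goodTimes U w w₀ (torusPartial i k), s ≤ t →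
      l2norm (torusConv (torusPartial i k) (fun x => w t x - w s x)) ≤ C * ∫ τ in s..t, m τ := by
  have hki := hk.torusPartial i
  have hB0 := h.B_nonneg
  obtain ⟨C, hC0, hC⟩ := exists_sum_l2norm_le hki
  refine ⟨B * C, by positivity, fun s hs t ht hst => ?_⟩
  set y := fun x => w t x - w s x with hy
  set z := torusConv (torusPartial i k) y with hz
  have hyd : MemL2Div y := h.memL2Div_sub s t
  have hyi : Integrable y := hyd.1.integrable (by norm_num)
  have hzL : MemLp z 2 := hki.memLp_conv hyd.1
  have hzd : MemL2Div z := ⟨hzL, isWeaklyDivFree_torusConv hki hyi hyd.2⟩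
  have hM0 : 0 ≤ ∫ τ in s..t, m τ := intervalIntegral.integral_nonneg hst fun τ _ => h.m_nonneg τ
  have e1 : ∫ x, inner ℝ (y x) (torusConv (torusPartial i k) z x) = -l2norm z ^ 2 := by
    rw [integral_inner_torusConv hki hyi (hzL.integrable (by norm_num)), l2norm_sq, ← integral_neg]
    congr 1; ext x
    have : torusConv (fun y => torusPartial i k (-y)) y x = -z x := by
      simp only [torusPartial_neg_of_even hkeven, hz, torusConv, neg_smul, integral_neg]
    rw [this, inner_neg_left, real_inner_self_eq_norm_sq]
  have e2 := h.abs_integral_transportForm_le hki hzL hst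
  rw [← h.integral_inner_sub_eq hki hs ht hzd, e1, abs_neg, abs_of_nonneg (sq_nonneg _)] at e2
  have e3 : l2norm z ^ 2 ≤ (B * C * ∫ τ in s..t, m τ) * l2norm z := by
    refine e2.trans ?_
    calc _ ≤ (∫ τ in s..t, m τ) * (B * (C * l2norm z)) :=
          mul_le_mul_of_nonneg_left (mul_le_mul_of_nonneg_left (hC z hzL) hB0) hM0
      _ = _ := by ring
  rcases (l2norm_nonneg z).eq_or_lt with h0 | h0
  · rw [← h0]; positivity
  · rw [sq] at e3
    exact le_of_mul_le_mul_right e3 h0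

theorem integrable_transportForm_self (h : TransportData U w w₀ m ℓ B) {k : Torus d L → ℝ}
    (hk : TorusSmooth k) : Integrable fun t => transportForm (U t) (w t) k (w t) := by
  obtain ⟨C, hC0, hC⟩ := exists_sum_l2norm_le (d := d) (L := L) hk
  have hB0 := h.B_nonneg
  refine (h.integrable_m.mul_const (B * (C * B))).mono' (measurable_transportForm h.measurable_U
    h.measurable_w h.measurable_w hk).aestronglyMeasurable (ae_of_all _ fun t => ?_)
  refine (h.abs_transportForm_le hk (h.memLp_w t) t).trans ?_
  refine mul_le_mul_of_nonneg_left (mul_le_mul_of_nonneg_left ?_ hB0) (h.m_nonneg t)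
  exact (hC _ (h.memLp_w t)).trans (mul_le_mul_of_nonneg_left (h.l2norm_w_le t) hC0)

/-- The mollified energy changes at most by the integral of the commutator. -/
theorem ae_abs_energy_sub_le (h : TransportData U w w₀ m ℓ B) {k : Torus d L → ℝ}
    (hk : TorusSmooth k) (hkeven : ∀ x, k (-x) = k x) :
    ∀ᵐ t ∂timeMeasure, |(∫ x, inner ℝ (w t x) (torusConv k (w t) x)) -
        ∫ x, inner ℝ (w₀ x) (torusConv k w₀ x)| ≤
      ∫ τ in (0 : ℝ)..t, 2 * |transportForm (U τ) (w τ) k (w τ)| := by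
  choose C hC0 hC using h.exists_l2norm_partial_conv_sub_le hk hkeven
  have hB0 := h.B_nonneg
  set G := {t : ℝ | t ∈ goodTimes U w w₀ k ∧ ∀ i, t ∈ goodTimes U w w₀ (torusPartial i k)} with hG
  have hGae : ∀ᵐ t ∂timeMeasure, t ∈ G := by
    filter_upwards [h.ae_mem_goodTimes hk,
      ae_all_iff.2 fun i => h.ae_mem_goodTimes (hk.torusPartial i)] with t h1 h2
    exact ⟨h1, h2⟩
  have hG0 : (0 : ℝ) ∈ G := ⟨h.zero_mem_goodTimes _, fun i => h.zero_mem_goodTimes _⟩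
  set F : ℝ → ℝ := fun t => ∫ x, inner ℝ (w t x) (torusConv k (w t) x) with hF
  set g : ℝ → ℝ := fun τ => 2 * |transportForm (U τ) (w τ) k (w τ)| with hg
  have hgi : Integrable g := (h.integrable_transportForm_self hk).abs.const_mul 2
  set M : ℝ → ℝ := fun t => ∫ τ in (0 : ℝ)..t, m τ with hM
  have hMsub : ∀ s t, M t - M s = ∫ τ in s..t, m τ := fun s t =>
    intervalIntegral.integral_interval_sub_left h.integrable_m.intervalIntegrable
      h.integrable_m.intervalIntegrable
  have hNsub : ∀ s t, (∫ τ in (0 : ℝ)..t, g τ) - (∫ τ in (0 : ℝ)..s, g τ) = ∫ τ in s..t, g τ :=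
    fun s t => intervalIntegral.integral_interval_sub_left hgi.intervalIntegrable
      hgi.intervalIntegrable
  have hMm : Monotone M := fun s t hst => by
    rw [← sub_nonneg, hMsub]
    exact intervalIntegral.integral_nonneg hst fun τ _ => h.m_nonneg τ
  have hMc : Continuous M :=
    intervalIntegral.continuous_primitive (fun _ _ => h.integrable_m.intervalIntegrable) 0
  have hdense : ∀ a b : ℝ, 0 ≤ a → a < b → ∃ c ∈ G, a < c ∧ c < b := by
    intro a b ha hab
    by_contra! hcon
    rw [ae_restrict_iff' measurableSet_Ioi] at hGae
    have h1 : Ioo a b ⊆ {t | ¬(t ∈ Ioi (0 : ℝ) → t ∈ G)} := fun t ht hcontra =>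
      absurd ht.2 (not_lt.2 (hcon t (hcontra (ha.trans_lt ht.1)) ht.1))
    have h2 := measure_mono_null h1 hGae
    rw [Real.volume_Ioo, ENNReal.ofReal_eq_zero] at h2
    linarith
  have hsup : ∀ s ∈ G, ∀ t ∈ G, 0 ≤ s → s ≤ t → |F t - F s| ≤
      (∫ τ in (0 : ℝ)..t, g τ) - (∫ τ in (0 : ℝ)..s, g τ) + B * (∑ i, C i) * 2 * (M t - M s) ^ 2 := by
    intro s hs t ht hs0 hst
    have hkt := hk.memLp_conv (h.memLp_w t)
    have hks := hk.memLp_conv (h.memLp_w s)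
    have hadd : MemL2Div (fun x => w t x + w s x) :=
      ⟨(h.memLp_w t).add (h.memLp_w s), (h.memL2Div_w t).2.add (h.integrable_w t)
        (h.integrable_w s) (h.memL2Div_w s).2⟩
    have e1 : F t - F s = ∫ τ in s..t, transportForm (U τ) (w τ) k (fun x => w t x + w s x) := by
      rw [← h.integral_inner_sub_eq hk hs.1 ht.1 hadd]
      have e2 : ∫ x, inner ℝ (w t x) (torusConv k (w s) x) =
          ∫ x, inner ℝ (w s x) (torusConv k (w t) x) := by
        rw [integral_inner_torusConv hk (h.integrable_w t) (h.integrable_w s)]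
        simp only [hkeven, real_inner_comm]
      have e3 : ∀ x, inner ℝ (w t x - w s x) (torusConv k (fun x => w t x + w s x) x) =
          (inner ℝ (w t x) (torusConv k (w t) x) + inner ℝ (w t x) (torusConv k (w s) x)) -
          (inner ℝ (w s x) (torusConv k (w t) x) + inner ℝ (w s x) (torusConv k (w s) x)) :=
        fun x => by
          rw [torusConv_add hk (h.integrable_w t) (h.integrable_w s), inner_sub_left,
            inner_add_right, inner_add_right]
      simp only [e3]
      have i1 := fun a b => integrable_inner_of_memLp (h.memLp_w a) (hk.memLp_conv (h.memLp_w b))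
      rw [integral_sub (f := fun x => inner ℝ (w t x) (torusConv k (w t) x) +
          inner ℝ (w t x) (torusConv k (w s) x)) (g := fun x => inner ℝ (w s x) (torusConv k (w t) x) +
          inner ℝ (w s x) (torusConv k (w s) x)) ((i1 t t).add (i1 t s)) ((i1 s t).add (i1 s s)),
        integral_add (i1 t t) (i1 t s), integral_add (i1 s t) (i1 s s), e2]
      ring
    have hpt : ∀ᵐ τ, τ ∈ Ioc s t →
        ‖transportForm (U τ) (w τ) k (fun x => w t x + w s x)‖ ≤
          g τ + m τ * (B * ((∑ i, C i) * (M t - M s)) * 2) := by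
      rw [ae_restrict_iff' measurableSet_Ioi] at hGae
      filter_upwards [hGae] with τ hτ hτst
      have hτG : τ ∈ G := hτ (hs0.trans_lt hτst.1)
      have hU := h.measurable_U_apply τ
      have hUm := h.norm_U_le τ
      have hwτ := h.memLp_w τ
      have hlin : transportForm (U τ) (w τ) k (fun x => w t x + w s x) =
          2 * transportForm (U τ) (w τ) k (w τ) +
          transportForm (U τ) (w τ) k (fun x => w t x - w τ x) -
          transportForm (U τ) (w τ) k (fun x => w τ x - w s x) := by
        rw [transportForm_add hU hUm hwτ hk (h.memLp_w t) (h.memLp_w s),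
          transportForm_sub hU hUm hwτ hk (h.memLp_w t) hwτ,
          transportForm_sub hU hUm hwτ hk hwτ (h.memLp_w s)]
        ring
      have hbd : ∀ a ∈ G, ∀ b ∈ G, s ≤ a → a ≤ b → b ≤ t →
          |transportForm (U τ) (w τ) k (fun x => w b x - w a x)| ≤
            m τ * (B * ((∑ i, C i) * (M t - M s))) := by
        intro a ha b hb hsa hab hbt
        refine (h.abs_transportForm_le hk (h.memL2Div_sub a b).1 τ).trans ?_
        refine mul_le_mul_of_nonneg_left (mul_le_mul_of_nonneg_left ?_ hB0) (h.m_nonneg τ)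
        rw [Finset.sum_mul]
        refine Finset.sum_le_sum fun i _ => ?_
        refine (hC i a (ha.2 i) b (hb.2 i) hab).trans (mul_le_mul_of_nonneg_left ?_ (hC0 i))
        rw [← hMsub]
        linarith [hMm hsa, hMm hbt]
      rw [hlin, Real.norm_eq_abs]
      have h1 := hbd τ hτG t ht hτst.1.le hτst.2 le_rfl
      have h2 := hbd s hs τ hτG le_rfl hτst.1.le hτst.2
      refine (abs_sub _ _).trans ?_
      have h3 := abs_add_le (2 * transportForm (U τ) (w τ) k (w τ))
        (transportForm (U τ) (w τ) k (fun x => w t x - w τ x))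
      rw [abs_mul, abs_two] at h3
      simp only [hg]
      linarith
    rw [e1, ← Real.norm_eq_abs]
    refine (intervalIntegral.norm_integral_le_of_norm_le hst hpt
      (hgi.add (h.integrable_m.mul_const _)).intervalIntegrable).trans (le_of_eq ?_)
    rw [intervalIntegral.integral_add hgi.intervalIntegrable
      (h.integrable_m.mul_const _).intervalIntegrable, intervalIntegral.integral_mul_const,
      hNsub, ← hMsub]
    ring
  filter_upwards [hGae, ae_restrict_mem measurableSet_Ioi] with t ht ht0
  have hfin := abs_sub_le_of_superlinear (A := G ∩ Ici 0) (F := F) (N := fun t => ∫ τ in (0 : ℝ)..t, g τ)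
    (M := M) (C := B * (∑ i, C i) * 2)
    (by have := Finset.sum_nonneg fun i (_ : i ∈ Finset.univ) => hC0 i; positivity)
    (fun a b ha hab => by
      obtain ⟨c, hc, hac, hcb⟩ := hdense a b ha hab
      exact ⟨c, ⟨hc, ha.trans hac.le⟩, hac, hcb⟩) hMc hMm
    (fun s hs t ht hst => hsup s hs.1 t ht.1 hs.2 hst) le_rfl ⟨hG0, mem_Ici.2 le_rfl⟩
    ⟨ht, mem_Ici.2 (le_of_lt (mem_Ioi.1 ht0))⟩ (le_of_lt (mem_Ioi.1 ht0))
  simpa only [hF, h.w_zero, intervalIntegral.integral_same, sub_zero] using hfin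

end TransportData

end

section

variable {d : ℕ} {L : ℝ} [Fact (0 < L)]

theorem integral_norm_sub_shift_sq_le {E : Type*} [NormedAddCommGroup E] [InnerProductSpace ℝ E]
    {f : Torus d L → E} (hf : MemLp f 2) {B : ℝ} (hB : l2norm f ≤ B) (z : Torus d L) :
    ∫ x, ‖f x - f (x - z)‖ ^ 2 ≤ (2 * B) ^ 2 := by
  have hs : MemLp (fun x => f (x - z)) 2 :=
    hf.comp_measurePreserving (measurePreserving_sub_right_torus z)
  have e : l2norm (fun x => f (x - z)) = l2norm f := by
    simp only [l2norm, integral_sub_right_eq_self (fun x => ‖f x‖ ^ 2) z]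
  rw [← l2norm_sq (fun x => f x - f (x - z))]
  refine pow_le_pow_left₀ (l2norm_nonneg _) ((l2norm_sub_le hf hs).trans ?_) 2
  rw [e]
  linarith

/-- A sequence of mollifiers with radii `1 / (n + 1)` eventually sees only small shifts. -/
theorem eventually_forall_shift_le {E : Type*} [NormedAddCommGroup E] [InnerProductSpace ℝ E]
    {f : Torus d L → E} (hf : MemLp f 2) {ε : ℝ} (hε : 0 < ε) :
    ∀ᶠ n : ℕ in Filter.atTop, ∀ z : Torus d L, ‖z‖ ≤ 1 / ((n : ℝ) + 1) →
      ∫ x, ‖f x - f (x - z)‖ ^ 2 ≤ ε := by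
  obtain ⟨δ, hδ, h⟩ := exists_integral_norm_sq_shift_le hf hε
  filter_upwards [tendsto_one_div_add_atTop_nhds_zero_nat.eventually (ge_mem_nhds hδ)] with n hn z hz
  exact h z (hz.trans hn)

theorem tendsto_integral_inner_mollify {f : Torus d L → EuclideanSpace ℝ (Fin d)}
    (hf : MemLp f 2) {C : ℝ} {k : ℕ → Torus d L → ℝ}
    (hk : ∀ n : ℕ, IsMollifier (k n) (1 / ((n : ℝ) + 1)) C) :
    Filter.Tendsto (fun n => ∫ x, inner ℝ (f x) (torusConv (k n) f x)) Filter.atTop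
      (nhds (∫ x, ‖f x‖ ^ 2)) := by
  rw [Metric.tendsto_nhds]
  intro ε hε
  filter_upwards [eventually_forall_shift_le hf (half_pos hε)] with n hn
  rw [dist_comm, Real.dist_eq]
  exact (abs_integral_norm_sq_sub_integral_inner_conv_le hf (hk n) (half_pos hε).le hn).trans_lt
    (half_lt_self hε)

namespace TransportData

variable {U w : ℝ → Torus d L → EuclideanSpace ℝ (Fin d)}
  {w₀ : Torus d L → EuclideanSpace ℝ (Fin d)} {m ℓ : ℝ → ℝ} {B : ℝ}

theorem abs_transportForm_self_le (h : TransportData U w w₀ m ℓ B) {k : Torus d L → ℝ}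
    {r C ε : ℝ} (hk : IsMollifier k r C) (hε : 0 ≤ ε) (t : ℝ)
    (hr : ∀ z, ‖z‖ ≤ r → ∫ x, ‖w t x - w t (x - z)‖ ^ 2 ≤ ε) :
    |transportForm (U t) (w t) k (w t)| ≤ ℓ t * (d * C * ε) := by
  obtain ⟨s, hs, hℓ⟩ := h.lipschitz_U t
  exact abs_integral_inner_transport_le (h.measurable_U_apply t) (h.norm_U_le t) (h.divFree_U t)
    (h.memLp_w t) hs (h.ℓ_nonneg t) hℓ hk hε hr

theorem tendsto_transportForm_self (h : TransportData U w w₀ m ℓ B) {C : ℝ} (hC : 0 ≤ C)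
    {k : ℕ → Torus d L → ℝ} (hk : ∀ n : ℕ, IsMollifier (k n) (1 / ((n : ℝ) + 1)) C) (t : ℝ) :
    Filter.Tendsto (fun n => transportForm (U t) (w t) (k n) (w t)) Filter.atTop (nhds 0) := by
  rw [Metric.tendsto_nhds]
  intro ε hε
  have hℓ := h.ℓ_nonneg t
  have hK : 0 < ℓ t * (d * C) + 1 := by positivity
  filter_upwards [eventually_forall_shift_le (h.memLp_w t) (div_pos hε hK)] with n hn
  rw [dist_zero_right, Real.norm_eq_abs]
  refine (h.abs_transportForm_self_le (hk n) (div_pos hε hK).le t hn).trans_lt ?_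
  rw [← mul_assoc, mul_div_assoc', div_lt_iff₀ hK]
  nlinarith

/-- The transport equation conserves the `L²` norm. -/
theorem ae_integral_norm_sq_eq (h : TransportData U w w₀ m ℓ B) :
    ∀ᵐ t ∂timeMeasure, ∫ x, ‖w t x‖ ^ 2 = ∫ x, ‖w₀ x‖ ^ 2 := by
  obtain ⟨C, hC0, hC⟩ := exists_isMollifier d L
  choose k hk using fun n : ℕ => hC (1 / ((n : ℝ) + 1)) (by positivity)
  filter_upwards [ae_all_iff.2 fun n => h.ae_abs_energy_sub_le (hk n).smooth (hk n).even] with t ht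
  have hw₀ : MemLp w₀ 2 := h.w_zero ▸ h.memLp_w 0
  have hlhs := ((tendsto_integral_inner_mollify (h.memLp_w t) hk).sub
    (tendsto_integral_inner_mollify hw₀ hk)).abs
  have hrhs : Filter.Tendsto (fun n => ∫ τ in (0 : ℝ)..t,
      2 * |transportForm (U τ) (w τ) (k n) (w τ)|) Filter.atTop (nhds (∫ _ in (0 : ℝ)..t, 0)) := by
    refine intervalIntegral.tendsto_integral_filter_of_dominated_convergence
      (fun τ => 2 * (ℓ τ * (d * C * (2 * B) ^ 2))) ?_ ?_ ?_ ?_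
    · exact Filter.Eventually.of_forall fun n => ((measurable_transportForm h.measurable_U
        h.measurable_w h.measurable_w (hk n).smooth).abs.const_mul 2).aestronglyMeasurable
    · refine Filter.Eventually.of_forall fun n => ae_of_all _ fun τ _ => ?_
      rw [norm_mul, Real.norm_eq_abs, Real.norm_eq_abs, abs_two, abs_abs]
      exact mul_le_mul_of_nonneg_left (h.abs_transportForm_self_le (hk n) (sq_nonneg _) τ fun z _ =>
        integral_norm_sub_shift_sq_le (h.memLp_w τ) (h.l2norm_w_le τ) z) zero_le_two
    · exact ((h.integrable_ℓ.mul_const _).const_mul 2).intervalIntegrable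
    · refine ae_of_all _ fun τ _ => ?_
      simpa using ((h.tendsto_transportForm_self hC0 hk τ).abs.const_mul 2)
  have hle := le_of_tendsto_of_tendsto' hlhs hrhs ht
  rw [intervalIntegral.integral_zero] at hle
  exact sub_eq_zero.1 (abs_nonpos_iff.1 hle)

end TransportData

end

section

variable {d : ℕ} {L : ℝ} [Fact (0 < L)]

theorem ae_forall_ae_of_ae_prod {α β : Type*} [MeasurableSpace α] [MeasurableSpace β]
    {μ : Measure α} {ν : Measure β} [SFinite ν] {E : Type*} [NormedAddCommGroup E]
    {f : α → β → E} (hf : AEStronglyMeasurable (fun z : α × β => f z.1 z.2) (μ.prod ν)) :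
    ∀ᵐ a ∂μ, (fun b => hf.mk _ (a, b)) =ᵐ[ν] f a := by
  filter_upwards [Measure.ae_ae_of_ae_prod hf.ae_eq_mk] with a ha
  filter_upwards [ha] with b hb using hb.symm

theorem MemTimeLp.integrable_toReal {f : ℝ → Torus d L → EuclideanSpace ℝ (Fin d)}
    (hf : MemTimeLp 1 ⊤ f) : Integrable (fun t => (eLpNorm (f t) ⊤).toReal) timeMeasure := by
  refine integrable_toReal_of_lintegral_ne_top hf.2.1.aemeasurable ?_
  have := hf.2.2
  rw [eLpNorm_one_eq_lintegral_enorm] at this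
  simpa using this.ne

theorem MemTimeLp.ae_ae_norm_le {f : ℝ → Torus d L → EuclideanSpace ℝ (Fin d)}
    (hf : MemTimeLp 1 ⊤ f) :
    ∀ᵐ t ∂timeMeasure, ∀ᵐ x, ‖f t x‖ ≤ (eLpNorm (f t) ⊤).toReal := by
  have h1 : ∫⁻ t, eLpNorm (f t) ⊤ ∂timeMeasure ≠ ⊤ := by
    have := hf.2.2
    rw [eLpNorm_one_eq_lintegral_enorm] at this
    simpa using this.ne
  filter_upwards [ae_lt_top' hf.2.1.aemeasurable h1] with t ht
  filter_upwards [ae_le_eLpNormEssSup (f := f t) (μ := volume)] with x hx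
  rw [← eLpNorm_exponent_top] at hx
  simpa using ENNReal.toReal_mono ht.ne hx

theorem exists_measurableSet_of_ae_timeMeasure {p : ℝ → Prop} (h : ∀ᵐ t ∂timeMeasure, p t) :
    ∃ S : Set ℝ, MeasurableSet S ∧ S ⊆ Ioi 0 ∧ (∀ᵐ t ∂timeMeasure, t ∈ S) ∧ ∀ t ∈ S, p t := by
  obtain ⟨s, hs, hsm, hsp⟩ := Filter.Eventually.exists_measurable_mem h
  exact ⟨s ∩ Ioi 0, hsm.inter measurableSet_Ioi, inter_subset_right,
    (Filter.eventually_of_mem hs fun _ h => h).and (ae_restrict_mem measurableSet_Ioi),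
    fun t ht => hsp t ht.1⟩

/-- A velocity field in `L¹(W^{1,∞})` has a representative obeying all bounds everywhere. -/
theorem exists_velocity_representative {U : ℝ → Torus d L → EuclideanSpace ℝ (Fin d)}
    (hU : MemTimeW1p 1 ⊤ U) (hUdiv : ∀ᵐ t ∂timeMeasure, IsWeaklyDivFree (U t)) :
    ∃ (V : ℝ → Torus d L → EuclideanSpace ℝ (Fin d)) (m ℓ : ℝ → ℝ),
      Measurable (fun p : ℝ × Torus d L => V p.1 p.2) ∧ (∀ t x, ‖V t x‖ ≤ m t) ∧
      Integrable m ∧ Integrable ℓ ∧ (∀ t, 0 ≤ ℓ t) ∧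
      (∀ t, ∃ s : Set (Torus d L), (∀ᵐ x, x ∈ s) ∧
        ∀ x ∈ s, ∀ y ∈ s, ‖V t x - V t y‖ ≤ ℓ t * ‖x - y‖) ∧
      (∀ t, IsWeaklyDivFree (V t)) ∧ ∀ᵐ t ∂timeMeasure, V t =ᵐ[volume] U t := by
  classical
  obtain ⟨hU0, G, hG, hUG⟩ := hU
  have hmi := hU0.integrable_toReal
  set m₁ := hmi.1.mk _ with hm₁
  have hm₁m : Measurable m₁ := hmi.1.stronglyMeasurable_mk.measurable
  set V₁ := hU0.1.mk _ with hV₁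
  have hV₁m : Measurable V₁ := hU0.1.stronglyMeasurable_mk.measurable
  obtain ⟨S, hSm, hS0, hSae, hS⟩ := exists_measurableSet_of_ae_timeMeasure
    (hmi.1.ae_eq_mk.and ((ae_forall_ae_of_ae_prod hU0.1).and (hU0.ae_ae_norm_le.and (hUdiv.and
      (hUG.and (ae_all_iff.2 fun i => (hG i).ae_ae_norm_le))))))
  set m : ℝ → ℝ := S.indicator m₁ with hm
  set ℓ : ℝ → ℝ := S.indicator fun t => ∑ i, (eLpNorm (G i t) ⊤).toReal with hℓ
  set A : Set (ℝ × Torus d L) := {p | p.1 ∈ S ∧ ‖V₁ p‖ ≤ m₁ p.1} with hA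
  have hAm : MeasurableSet A := (measurable_fst hSm).inter
    (measurableSet_le hV₁m.norm (hm₁m.comp measurable_fst))
  set V : ℝ → Torus d L → EuclideanSpace ℝ (Fin d) := fun t x => A.indicator V₁ (t, x) with hV
  have hVS : ∀ t ∈ S, V t =ᵐ[volume] U t := fun t ht => by
    obtain ⟨h1, h2, h3, -⟩ := hS t ht
    filter_upwards [h2, h3] with x h2 h3
    have : (t, x) ∈ A := ⟨ht, by
      change ‖V₁ (t, x)‖ ≤ m₁ t
      rw [hm₁, ← h1, hV₁, h2]; exact h3⟩
    simp only [hV, indicator_of_mem this]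
    exact h2
  have hVS' : ∀ t ∉ S, ∀ x, V t x = 0 := fun t ht x =>
    indicator_of_notMem (fun h => ht h.1) _
  have hℓ0 : ∀ t, 0 ≤ ℓ t := fun t =>
    indicator_nonneg (fun t _ => Finset.sum_nonneg fun i _ => ENNReal.toReal_nonneg) t
  refine ⟨V, m, ℓ, hV₁m.indicator hAm, fun t x => ?_, ?_, ?_, hℓ0, fun t => ?_, fun t => ?_, ?_⟩
  · by_cases hx : (t, x) ∈ A
    · simp only [hV, indicator_of_mem hx, hm, indicator_of_mem hx.1]
      exact hx.2
    · simp only [hV, indicator_of_notMem hx, norm_zero, hm]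
      refine indicator_nonneg (fun t ht => ?_) t
      rw [hm₁, ← (hS t ht).1]
      exact ENNReal.toReal_nonneg
  · rw [hm, integrable_indicator_iff hSm]
    exact IntegrableOn.mono_set (hmi.congr hmi.1.ae_eq_mk) hS0
  · rw [hℓ, integrable_indicator_iff hSm]
    exact IntegrableOn.mono_set
      (integrable_finsetSum _ fun i _ => (hG i).integrable_toReal) hS0
  · by_cases ht : t ∈ S
    · obtain ⟨h1, h2, h3, h4, h5, h6⟩ := hS t ht
      have hUt : Integrable (U t) := by
        have hmeas : AEStronglyMeasurable (U t) volume :=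
          (hV₁m.comp measurable_prodMk_left).aestronglyMeasurable.congr h2
        exact Integrable.of_bound hmeas _ h3
      obtain ⟨s, hs, hsl⟩ := exists_lipschitz_set_of_isWeakPartial hUt h5 h6
      refine ⟨s ∩ {x | V t x = U t x}, hs.and (hVS t ht), fun x hx y hy => ?_⟩
      rw [show V t x = U t x from hx.2, show V t y = U t y from hy.2, hℓ, indicator_of_mem ht]
      exact hsl x hx.1 y hy.1
    · refine ⟨univ, by simp, fun x _ y _ => ?_⟩
      rw [hVS' t ht, hVS' t ht, sub_zero, norm_zero]
      exact mul_nonneg (hℓ0 t) (norm_nonneg _)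
  · by_cases ht : t ∈ S
    · exact (hS t ht).2.2.2.1.congr_ae (hVS t ht).symm
    · intro ψ _
      simp [hVS' t ht]
  · filter_upwards [hSae] with t ht using hVS t ht

/-- A field in `L^∞(L²_div)`, together with an initial value, has a representative obeying all
bounds everywhere and extended to negative times by the initial value. -/
theorem exists_solution_representative {u : ℝ → Torus d L → EuclideanSpace ℝ (Fin d)}
    {u₀ : Torus d L → EuclideanSpace ℝ (Fin d)} (hu : MemTimeLp ⊤ 2 u)
    (hudiv : ∀ᵐ t ∂timeMeasure, IsWeaklyDivFree (u t)) (hu₀ : MemL2Div u₀) :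
    ∃ (w : ℝ → Torus d L → EuclideanSpace ℝ (Fin d)) (w₀ : Torus d L → EuclideanSpace ℝ (Fin d))
      (B : ℝ), Measurable (fun p : ℝ × Torus d L => w p.1 p.2) ∧ (∀ t, MemL2Div (w t)) ∧
      (∀ t, l2norm (w t) ≤ B) ∧ (∀ t ≤ 0, w t = w₀) ∧ w₀ =ᵐ[volume] u₀ ∧
      ∀ᵐ t ∂timeMeasure, w t =ᵐ[volume] u t := by
  classical
  set w₀ := hu₀.1.1.mk _ with hw₀
  have hw₀m : Measurable w₀ := hu₀.1.1.stronglyMeasurable_mk.measurable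
  have hw₀u : w₀ =ᵐ[volume] u₀ := hu₀.1.1.ae_eq_mk.symm
  have hw₀d : MemL2Div w₀ := ⟨hu₀.1.ae_eq hw₀u.symm, hu₀.2.congr_ae hw₀u.symm⟩
  set V := hu.1.mk _ with hV
  have hVm : Measurable V := hu.1.stronglyMeasurable_mk.measurable
  set K := eLpNormEssSup (fun t => eLpNorm (u t) 2) timeMeasure with hK
  have hKt : K ≠ ⊤ := by
    have := hu.2.2
    rw [eLpNorm_exponent_top] at this
    exact this.ne
  obtain ⟨S, hSm, hS0, hSae, hS⟩ := exists_measurableSet_of_ae_timeMeasure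
    ((ae_forall_ae_of_ae_prod hu.1).and (hudiv.and
      (ae_le_eLpNormEssSup (f := fun t => eLpNorm (u t) 2) (μ := timeMeasure))))
  set A : Set (ℝ × Torus d L) := Prod.fst ⁻¹' S with hA
  have hAm : MeasurableSet A := measurable_fst hSm
  set w : ℝ → Torus d L → EuclideanSpace ℝ (Fin d) :=
    fun t => if t ∈ S then fun x => V (t, x) else w₀ with hw
  have hwS : ∀ t ∈ S, w t = fun x => V (t, x) := fun t ht => if_pos ht
  have hwS' : ∀ t ∉ S, w t = w₀ := fun t ht => if_neg ht
  have hVL : ∀ t ∈ S, MemLp (fun x => V (t, x)) 2 ∧ l2norm (fun x => V (t, x)) ≤ K.toReal := by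
    intro t ht
    obtain ⟨h1, -, h3⟩ := hS t ht
    have h4 : eLpNorm (fun x => V (t, x)) 2 ≤ K := by
      rw [eLpNorm_congr_ae h1]
      exact h3
    have hL : MemLp (fun x => V (t, x)) 2 :=
      ⟨(hVm.comp measurable_prodMk_left).aestronglyMeasurable, h4.trans_lt hKt.lt_top⟩
    refine ⟨hL, ?_⟩
    rw [← norm_toLp_eq_l2norm hL, Lp.norm_toLp]
    exact ENNReal.toReal_mono hKt h4
  refine ⟨w, w₀, max K.toReal (l2norm w₀), ?_, fun t => ?_, fun t => ?_, fun t ht => ?_, hw₀u, ?_⟩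
  · have : (fun p : ℝ × Torus d L => w p.1 p.2) = A.piecewise V fun p => w₀ p.2 := by
      ext1 p
      by_cases hp : p.1 ∈ S
      · rw [hwS _ hp]
        exact (piecewise_eq_of_mem A V (fun p => w₀ p.2) hp).symm
      · rw [hwS' _ hp]
        exact (piecewise_eq_of_notMem A V (fun p => w₀ p.2) hp).symm
    rw [this]
    exact Measurable.piecewise hAm hVm (hw₀m.comp measurable_snd)
  · by_cases ht : t ∈ S
    · rw [hwS t ht]
      exact ⟨(hVL t ht).1, (hS t ht).2.1.congr_ae (hS t ht).1.symm⟩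
    · rwa [hwS' t ht]
  · by_cases ht : t ∈ S
    · rw [hwS t ht]
      exact (hVL t ht).2.trans (le_max_left _ _)
    · rw [hwS' t ht]
      exact le_max_right _ _
  · exact hwS' t fun h => absurd (hS0 h) (not_lt.2 ht)
  · filter_upwards [hSae] with t ht
    rw [hwS t ht]
    exact (hS t ht).1

end

section

section TestField

variable {d : ℕ} {L : ℝ} {φ : ℝ → Torus d L → EuclideanSpace ℝ (Fin d)}

theorem IsTestField.continuous_timeDeriv (hφ : IsTestField φ) :
    Continuous fun z : ℝ × Torus d L => deriv (fun s => φ s z.2) z.1 := by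
  have hq : IsOpenQuotientMap (Prod.map (id : ℝ → ℝ) (toTorus d L)) :=
    IsOpenQuotientMap.id.prodMap toTorus_isOpenQuotientMap
  rw [hq.isQuotientMap.continuous_iff]
  have h : (fun z : ℝ × Torus d L => deriv (fun s => φ s z.2) z.1) ∘ Prod.map id (toTorus d L) =
      fun z => fderiv ℝ (fun z : ℝ × (Fin d → ℝ) => φ z.1 (toTorus d L z.2)) z (1, 0) := by
    ext1 z
    exact ((hφ.smooth.differentiable (by simp) z).hasFDerivAt.comp_hasDerivAt z.1
      ((hasDerivAt_id z.1).prodMk (hasDerivAt_const z.1 z.2))).deriv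
  rw [h]
  exact (hφ.smooth.continuous_fderiv (by simp)).clm_apply continuous_const

theorem IsTestField.continuous_torusPartial (hφ : IsTestField φ) (i : Fin d) :
    Continuous fun z : ℝ × Torus d L => torusPartial i (φ z.1) z.2 := by
  have hq : IsOpenQuotientMap (Prod.map (id : ℝ → ℝ) (toTorus d L)) :=
    IsOpenQuotientMap.id.prodMap toTorus_isOpenQuotientMap
  rw [hq.isQuotientMap.continuous_iff]
  have h : (fun z : ℝ × Torus d L => torusPartial i (φ z.1) z.2) ∘ Prod.map id (toTorus d L) =
      fun z => fderiv ℝ (fun z : ℝ × (Fin d → ℝ) => φ z.1 (toTorus d L z.2)) z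
        (0, Pi.single i 1) := by
    ext1 z
    have h := (hφ.smooth.differentiable (by simp) z).hasFDerivAt
    have h' := HasFDerivAt.comp (g := fun z : ℝ × (Fin d → ℝ) => φ z.1 (toTorus d L z.2)) z.2 h
      (hasFDerivAt_prodMk_right (𝕜 := ℝ) z.1 z.2)
    exact torusPartial_toTorus (L := L) (f := φ z.1) i h'
  rw [h]
  exact (hφ.smooth.continuous_fderiv (by simp)).clm_apply continuous_const

/-- The derivatives of a test field are bounded, and vanish outside a compact set of times. -/
theorem IsTestField.exists_bounds [Fact (0 < L)] (hφ : IsTestField φ) :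
    ∃ (K : Set ℝ) (a : ℝ), IsCompact K ∧ 0 ≤ a ∧
      (∀ t x, ‖deriv (fun s => φ s x) t‖ ≤ K.indicator (fun _ => a) t) ∧
      ∀ i t x, ‖torusPartial i (φ t) x‖ ≤ a := by
  set K := Prod.fst '' tsupport (fun z : ℝ × Torus d L => φ z.1 z.2) with hK
  have hKc : IsCompact K := IsCompact.image hφ.compactSupport continuous_fst
  have hφ0 : ∀ t ∉ K, ∀ x, φ t x = 0 := fun t ht x => by
    by_contra h
    exact ht ⟨(t, x), subset_tsupport _ h, rfl⟩
  have h1 : ∀ t ∉ K, ∀ x, deriv (fun s => φ s x) t = 0 := fun t ht x => by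
    have : (fun s => φ s x) =ᶠ[nhds t] fun _ => 0 := by
      filter_upwards [hKc.isClosed.isOpen_compl.mem_nhds ht] with s hs using hφ0 s hs x
    rw [this.deriv_eq, deriv_const]
  have h2 : ∀ i, ∀ t ∉ K, ∀ x, torusPartial i (φ t) x = 0 := fun i t ht x => by
    simp [torusPartial, hφ0 t ht]
  have hKu : IsCompact (K ×ˢ (univ : Set (Torus d L))) := hKc.prod isCompact_univ
  obtain ⟨a, ha⟩ := hKu.exists_bound_of_continuousOn hφ.continuous_timeDeriv.continuousOn
  choose b hb using fun i => hKu.exists_bound_of_continuousOn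
    (hφ.continuous_torusPartial i).continuousOn
  set c := |a| + ∑ i, |b i| with hc
  have hb0 : 0 ≤ ∑ i, |b i| := Finset.sum_nonneg fun i _ => abs_nonneg _
  have hc0 : 0 ≤ c := by positivity
  refine ⟨K, c, hKc, hc0, fun t x => ?_, fun i t x => ?_⟩
  · by_cases ht : t ∈ K
    · rw [indicator_of_mem ht]
      have := ha (t, x) ⟨ht, trivial⟩
      simp only at this
      linarith [le_abs_self a]
    · rw [h1 t ht, indicator_of_notMem ht, norm_zero]
  · by_cases ht : t ∈ K
    · have h3 := hb i (t, x) ⟨ht, trivial⟩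
      have h4 := Finset.single_le_sum (fun i _ => abs_nonneg (b i)) (Finset.mem_univ i)
      simp only at h3
      linarith [le_abs_self (b i), abs_nonneg a]
    · rw [h2 i t ht, norm_zero]
      exact hc0

end TestField

variable {d : ℕ} {L : ℝ} [Fact (0 < L)]

namespace TransportData

variable {U v w : ℝ → Torus d L → EuclideanSpace ℝ (Fin d)}
  {v₀ w₀ : Torus d L → EuclideanSpace ℝ (Fin d)} {m ℓ : ℝ → ℝ} {B B' : ℝ}
  {φ : ℝ → Torus d L → EuclideanSpace ℝ (Fin d)}

/-- The integrand of the weak formulation. -/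
def weakIntegrand (U w φ : ℝ → Torus d L → EuclideanSpace ℝ (Fin d)) (t : ℝ) (x : Torus d L) : ℝ :=
  inner ℝ (w t x) (deriv (fun s => φ s x) t) +
    inner ℝ (∑ i, U t x i • torusPartial i (φ t) x) (w t x)

theorem measurable_weakIntegrand (h : TransportData U w w₀ m ℓ B) (hφ : IsTestField φ) :
    Measurable fun p : ℝ × Torus d L => weakIntegrand U w φ p.1 p.2 := by
  have hU := h.measurable_U
  have hUi : ∀ i, Measurable fun p : ℝ × Torus d L => U p.1 p.2 i := fun i => by fun_prop
  exact (h.measurable_w.inner hφ.continuous_timeDeriv.measurable).add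
    (Measurable.inner (Finset.measurable_fun_sum _ fun i _ =>
      (hUi i).smul (hφ.continuous_torusPartial i).measurable) h.measurable_w)

theorem exists_norm_weakIntegrand_le (h : TransportData U w w₀ m ℓ B) (hφ : IsTestField φ) :
    ∃ c : ℝ → ℝ, Integrable c ∧ (∀ t, 0 ≤ c t) ∧
      ∀ t x, ‖weakIntegrand U w φ t x‖ ≤ c t * ‖w t x‖ := by
  obtain ⟨K, a, hK, ha0, h1, h2⟩ := hφ.exists_bounds
  refine ⟨fun t => K.indicator (fun _ => a) t + m t * (d * a), ?_, fun t => ?_, fun t x => ?_⟩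
  · refine Integrable.add ?_ (h.integrable_m.mul_const _)
    rw [integrable_indicator_iff hK.measurableSet]
    exact integrableOn_const hK.measure_lt_top.ne
  · exact add_nonneg (indicator_nonneg (fun _ _ => ha0) t)
      (mul_nonneg (h.m_nonneg t) (by positivity))
  · rw [add_mul]
    refine (norm_add_le _ _).trans (add_le_add ?_ ?_)
    · rw [mul_comm]
      exact (norm_inner_le_norm _ _).trans
        (mul_le_mul_of_nonneg_left (h1 t x) (norm_nonneg _))
    · refine (norm_inner_le_norm _ _).trans
        (mul_le_mul_of_nonneg_right ((norm_sum_le _ _).trans ?_) (norm_nonneg _))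
      calc _ ≤ ∑ _ : Fin d, m t * a := Finset.sum_le_sum fun i _ => by
            rw [norm_smul]
            exact mul_le_mul ((PiLp.norm_apply_le (U t x) i).trans (h.norm_U_le t x)) (h2 i t x)
              (norm_nonneg _) (h.m_nonneg t)
        _ = _ := by simp; ring

theorem integrable_weakIntegrand (h : TransportData U w w₀ m ℓ B) (hφ : IsTestField φ) (t : ℝ) :
    Integrable (weakIntegrand U w φ t) := by
  obtain ⟨c, -, -, hc⟩ := h.exists_norm_weakIntegrand_le hφ
  exact ((h.integrable_w t).norm.const_mul (c t)).mono'
    ((h.measurable_weakIntegrand hφ).comp measurable_prodMk_left).aestronglyMeasurable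
    (ae_of_all _ (hc t))

theorem integrable_integral_weakIntegrand (h : TransportData U w w₀ m ℓ B)
    (hφ : IsTestField φ) : Integrable fun t => ∫ x, weakIntegrand U w φ t x := by
  obtain ⟨c, hci, hc0, hc⟩ := h.exists_norm_weakIntegrand_le hφ
  refine (hci.mul_const (Real.sqrt (volume.real (univ : Set (Torus d L))) * B)).mono'
    (h.measurable_weakIntegrand hφ).stronglyMeasurable.integral_prod_right'.aestronglyMeasurable
    (ae_of_all _ fun t => ?_)
  refine (norm_integral_le_of_norm_le ((h.integrable_w t).norm.const_mul (c t))
    (ae_of_all _ (hc t))).trans ?_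
  rw [integral_const_mul]
  exact mul_le_mul_of_nonneg_left ((integral_norm_le_l2norm (h.memLp_w t)).trans
    (mul_le_mul_of_nonneg_left (h.l2norm_w_le t) (Real.sqrt_nonneg _))) (hc0 t)

/-- The equation is linear in the solution. -/
theorem sub (hv : TransportData U v v₀ m ℓ B) (hw : TransportData U w w₀ m ℓ B') :
    TransportData U (fun t x => v t x - w t x) (fun x => v₀ x - w₀ x) m ℓ (B + B') where
  measurable_U := hv.measurable_U
  measurable_w := hv.measurable_w.sub hw.measurable_w
  norm_U_le := hv.norm_U_le
  integrable_m := hv.integrable_m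
  integrable_ℓ := hv.integrable_ℓ
  ℓ_nonneg := hv.ℓ_nonneg
  lipschitz_U := hv.lipschitz_U
  divFree_U := hv.divFree_U
  memL2Div_w t := ⟨(hv.memLp_w t).sub (hw.memLp_w t), (hv.memL2Div_w t).2.sub (hv.integrable_w t)
    (hw.integrable_w t) (hw.memL2Div_w t).2⟩
  l2norm_w_le t := (l2norm_sub_le (hv.memLp_w t) (hw.memLp_w t)).trans
    (add_le_add (hv.l2norm_w_le t) (hw.l2norm_w_le t))
  w_of_nonpos t ht := by rw [hv.w_of_nonpos t ht, hw.w_of_nonpos t ht]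
  weakForm φ hφ := by
    have e1 : ∀ t x, inner ℝ (v t x - w t x) (deriv (fun s => φ s x) t)
          + inner ℝ (∑ i, U t x i • torusPartial i (φ t) x) (v t x - w t x) =
        weakIntegrand U v φ t x - weakIntegrand U w φ t x := fun t x => by
      simp only [weakIntegrand, inner_sub_left, inner_sub_right]
      ring
    have hφ0 : MemLp (φ 0) 2 := TorusSmooth.memLp (f := φ 0)
      (hφ.smooth.comp (contDiff_prodMk_right (0 : ℝ))) 2
    have hv₀ : MemLp v₀ 2 := hv.w_zero ▸ hv.memLp_w 0
    have hw₀ : MemLp w₀ 2 := hw.w_zero ▸ hw.memLp_w 0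
    have e2 : ∫ x, inner ℝ (v₀ x - w₀ x) (φ 0 x) =
        (∫ x, inner ℝ (v₀ x) (φ 0 x)) - ∫ x, inner ℝ (w₀ x) (φ 0 x) := by
      rw [← integral_sub (integrable_inner_of_memLp hv₀ hφ0) (integrable_inner_of_memLp hw₀ hφ0)]
      simp only [inner_sub_left]
    have e3 : ∀ t, ∫ x, (weakIntegrand U v φ t x - weakIntegrand U w φ t x) =
        (∫ x, weakIntegrand U v φ t x) - ∫ x, weakIntegrand U w φ t x := fun t =>
      integral_sub (hv.integrable_weakIntegrand hφ t) (hw.integrable_weakIntegrand hφ t)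
    simp only [e1, e2, e3]
    rw [integral_sub (hv.integrable_integral_weakIntegrand hφ).integrableOn
      (hw.integrable_integral_weakIntegrand hφ).integrableOn]
    have hv' := hv.weakForm φ hφ
    have hw' := hw.weakForm φ hφ
    simp only [weakIntegrand]
    linarith

end TransportData

/-- The weak formulation only depends on almost everywhere classes. -/
theorem weakForm_congr_ae {U U' u u' φ : ℝ → Torus d L → EuclideanSpace ℝ (Fin d)}
    {u₀ u₀' : Torus d L → EuclideanSpace ℝ (Fin d)}
    (hU : ∀ᵐ t ∂timeMeasure, U' t =ᵐ[volume] U t) (hu : ∀ᵐ t ∂timeMeasure, u' t =ᵐ[volume] u t)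
    (hu₀ : u₀' =ᵐ[volume] u₀)
    (h : (∫ t in Ioi (0 : ℝ), ∫ x,
        (inner ℝ (u t x) (deriv (fun s => φ s x) t)
          + inner ℝ (∑ i, U t x i • torusPartial i (φ t) x) (u t x)))
      + ∫ x, inner ℝ (u₀ x) (φ 0 x) = 0) :
    (∫ t in Ioi (0 : ℝ), ∫ x,
        (inner ℝ (u' t x) (deriv (fun s => φ s x) t)
          + inner ℝ (∑ i, U' t x i • torusPartial i (φ t) x) (u' t x)))
      + ∫ x, inner ℝ (u₀' x) (φ 0 x) = 0 := by
  refine Eq.trans ?_ h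
  congr 1
  · refine integral_congr_ae (μ := timeMeasure) ?_
    filter_upwards [hU, hu] with t h1 h2
    refine integral_congr_ae ?_
    filter_upwards [h1, h2] with x h1 h2
    simp only [h1, h2]
  · refine integral_congr_ae ?_
    filter_upwards [hu₀] with x hx
    simp only [hx]

/-- The `L²` distance between two weak solutions is conserved. -/
theorem IsWeakSolution.ae_integral_norm_sub_sq_eq
    {U u v : ℝ → Torus d L → EuclideanSpace ℝ (Fin d)}
    {u₀ v₀ : Torus d L → EuclideanSpace ℝ (Fin d)} (hU : MemTimeW1p 1 ⊤ U)
    (hUdiv : ∀ᵐ t ∂timeMeasure, IsWeaklyDivFree (U t)) (hu₀ : MemL2Div u₀) (hv₀ : MemL2Div v₀)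
    (hu : IsWeakSolution U u₀ u) (hv : IsWeakSolution U v₀ v) :
    ∀ᵐ t ∂timeMeasure, MemLp (fun x => u t x - v t x) 2 ∧
      ∫ x, ‖u t x - v t x‖ ^ 2 = ∫ x, ‖u₀ x - v₀ x‖ ^ 2 := by
  obtain ⟨V, m, ℓ, hVm, hVn, hm, hℓ, hℓ0, hVl, hVd, hVU⟩ := exists_velocity_representative hU hUdiv
  have key : ∀ {u u₀}, MemL2Div u₀ → IsWeakSolution U u₀ u →
      ∃ w w₀ B, TransportData V w w₀ m ℓ B ∧ w₀ =ᵐ[volume] u₀ ∧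
        ∀ᵐ t ∂timeMeasure, w t =ᵐ[volume] u t := by
    intro u u₀ hu₀ hu
    obtain ⟨w, w₀, B, hwm, hwL, hwB, hw0, hw₀, hwu⟩ :=
      exists_solution_representative hu.bounded hu.divFree hu₀
    exact ⟨w, w₀, B, ⟨hVm, hwm, hVn, hm, hℓ, hℓ0, hVl, hVd, hwL, hwB, hw0, fun φ hφ =>
      weakForm_congr_ae hVU hwu hw₀ (hu.weakForm φ hφ)⟩, hw₀, hwu⟩
  obtain ⟨a, a₀, A, ha, ha₀, hau⟩ := key hu₀ hu
  obtain ⟨b, b₀, B, hb, hb₀, hbv⟩ := key hv₀ hv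
  have hab := ha.sub hb
  filter_upwards [hab.ae_integral_norm_sq_eq, hau, hbv] with t ht h1 h2
  have h3 : (fun x => a t x - b t x) =ᵐ[volume] fun x => u t x - v t x := h1.sub h2
  refine ⟨(hab.memLp_w t).ae_eq h3, ?_⟩
  have e1 : ∫ x, ‖u t x - v t x‖ ^ 2 = ∫ x, ‖a t x - b t x‖ ^ 2 :=
    integral_congr_ae (h3.mono fun x hx => by simp only [hx])
  have e2 : ∫ x, ‖a₀ x - b₀ x‖ ^ 2 = ∫ x, ‖u₀ x - v₀ x‖ ^ 2 :=
    integral_congr_ae ((ha₀.sub hb₀).mono fun x hx => by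
      simp only [Pi.sub_apply] at hx; simp only [hx])
  rw [e1, ht, e2]

end

end

theorem lemma2p4 (d : ℕ) (L : ℝ) [Fact (0 < L)] (q : ℝ≥0∞) (hq : 1 < q)
    (U : ℝ → Torus d L → EuclideanSpace ℝ (Fin d))
    (hUq : MemTimeW1p ∞ q U) (hU : MemTimeW1p 1 ∞ U)
    (hUdiv : ∀ᵐ t ∂timeMeasure, IsWeaklyDivFree (U t)) :
    -- uniqueness of weak solutions
    (∀ u₀ : Torus d L → EuclideanSpace ℝ (Fin d), MemL2Div u₀ →
      ∀ u v : ℝ → Torus d L → EuclideanSpace ℝ (Fin d),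
        IsWeakSolution U u₀ u → IsWeakSolution U u₀ v →
          ∀ᵐ t ∂timeMeasure, u t =ᵐ[volume] v t) ∧
    -- stability estimate, for data in `L²_div`
    (∀ u₀ v₀ : Torus d L → EuclideanSpace ℝ (Fin d), MemL2Div u₀ → MemL2Div v₀ →
      ∀ u v : ℝ → Torus d L → EuclideanSpace ℝ (Fin d),
        IsWeakSolution U u₀ u → IsWeakSolution U v₀ v →
          ∀ᵐ t ∂timeMeasure, ∫ x, ‖u t x - v t x‖ ^ 2 ≤ ∫ x, ‖u₀ x - v₀ x‖ ^ 2) ∧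
    -- equality, for data in `H¹_div`
    (∀ u₀ v₀ : Torus d L → EuclideanSpace ℝ (Fin d), MemH1Div u₀ → MemH1Div v₀ →
      ∀ u v : ℝ → Torus d L → EuclideanSpace ℝ (Fin d),
        IsWeakSolution U u₀ u → IsWeakSolution U v₀ v →
          ∀ᵐ t ∂timeMeasure, ∫ x, ‖u t x - v t x‖ ^ 2 = ∫ x, ‖u₀ x - v₀ x‖ ^ 2) := by

  refine ⟨fun u₀ hu₀ u v hu hv => ?_, fun u₀ v₀ hu₀ hv₀ u v hu hv => ?_,
    fun u₀ v₀ hu₀ hv₀ u v hu hv => ?_⟩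
  · filter_upwards [hu.ae_integral_norm_sub_sq_eq hU hUdiv hu₀ hu₀ hv] with t ⟨h1, h2⟩
    simp only [sub_self, norm_zero, ne_eq, OfNat.ofNat_ne_zero, not_false_eq_true, zero_pow,
      integral_zero] at h2
    rw [integral_eq_zero_iff_of_nonneg (fun _ => sq_nonneg _) (_root_.MemLp.integrable_norm_sq h1)] at h2
    filter_upwards [h2] with x hx
    simpa [sub_eq_zero] using hx
  · filter_upwards [hu.ae_integral_norm_sub_sq_eq hU hUdiv hu₀ hv₀ hv] with t ht using ht.2.le
  · filter_upwards [hu.ae_integral_norm_sub_sq_eq hU hUdiv hu₀.1 hv₀.1 hv] with t ht using ht.2
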